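/- Let $f:\mathbb{R}^d\to\mathbb{R}$ be bounded below with infimum $f^\star$, and $M$-smooth with $M>0$, i.e. $f$ is differentiable and $\|\nabla f(x)-\nabla f(y)\|\le M\|x-y\|$ for all $x,y$. Let $\xi_1,\xi_2,\dots$ be independent random elements and let $g(x,\xi)\in\mathbb{R}^d$ be a (jointly measurable) stochastic gradient such that, for all $x\in\mathbb{R}^d$ and all $t$, $\mathbb{E}[g(x,\xi_t)]=\nabla f(x)$ and $\mathbb{E}[\exp(\|\nabla f(x)-g(x,\xi_t)\|^2/\sigma^2)]\le e$, where $\sigma\ge 0$ (for $\sigma=0$ the last condition means $g(x,\xi_t)=\nabla f(x)$ almost surely). Let $\alpha,\beta>0$ and $0\le\mu<1$ satisfy $4\alpha\le\frac{\sqrt\beta(1-\mu)^2}{2M(1+\mu)}$. Starting from $x_1\in\mathbb{R}^d$ and $m_0=0$, run for $t=1,\dots,T$ the momentum algorithm with delayed AdaGrad step sizes \[ g_t=g(x_t,\xi_t),\qquad \eta_{t,j}=\frac{\alpha}{\sqrt{\beta+\sum_{i=1}^{t-1}g_{i,j}^2}}\quad(j=1,\dots,d),\qquad m_t=\mu m_{t-1}+\eta_t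 g_t,\qquad x_{t+1}=x_t-m_t, \] where $\eta_tg_t$ is the coordinate-wise product. Then for every $T\ge1$ and every $\delta\in(0,1)$, with probability at least $1-\delta$, \[ \min_{1\le t\le T}\|\nabla f(x_t)\|^2\le\frac1T\max\left(\frac{4C(T)^2}{\alpha^2},\ \frac{C(T)}{\alpha}\sqrt{2\beta+4T\sigma^2\ln\frac{3Te}{\delta}}\right), \] where \[ C(T)=c\left(\frac1\alpha+\frac{d\left(\alpha+\sigma^2\left(\alpha\ln\frac T\delta+\frac{\ln\frac1\delta}{1-\mu}\right)\right)}{1-\mu}\right). \] Here the constant $c>0$ depends only on $M$, $\beta$, an upper bound on $f(x_1)-f^\star$ and, if $\sigma\neq0$, a positive lower bound $\sigma_0\le\sigma$; it does not depend on $d$, $f$, $x_1$, the oracle, $\alpha$, $\mu$, $T$, $\delta$, nor otherwise on $\sigma$. -/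

import Mathlib

open MeasureTheory ProbabilityTheory

noncomputable section

namespace DelayedAdaGrad

/-- `f` is `M`-smooth: differentiable with an `M`-Lipschitz gradient. -/
def IsSmooth {d : ℕ} (M : ℝ) (f : EuclideanSpace ℝ (Fin d) → ℝ) : Prop :=
  Differentiable ℝ f ∧ ∀ x y, ‖gradient f x - gradient f y‖ ≤ M * ‖x - y‖

/-- The oracle `g` with random seed `ξ` is unbiased: `E[g(x, ξ)] = ∇f(x)` for every fixed `x`. -/
def IsUnbiased {d : ℕ} {Ξ Ω : Type*} [MeasurableSpace Ω]
    (f : EuclideanSpace ℝ (Fin d) → ℝ)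
    (g : EuclideanSpace ℝ (Fin d) → Ξ → EuclideanSpace ℝ (Fin d))
    (P : Measure Ω) (ξ : Ω → Ξ) : Prop :=
  ∀ x, Integrable (fun ω => g x (ξ ω)) P ∧ ∫ ω, g x (ξ ω) ∂P = gradient f x

/-- Sub-Gaussian noise at level `σ`:
`E[exp(‖∇f(x) - g(x, ξ)‖² / σ²)] ≤ exp 1` for every fixed `x`.
For `σ = 0` the quotient is read as `0 / 0 = 0` and `r / 0 = ∞` for `r > 0`,
so that the condition says that the oracle is almost surely exact. -/
def HasSubGaussianNoise {d : ℕ} {Ξ Ω : Type*} [MeasurableSpace Ω]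
    (f : EuclideanSpace ℝ (Fin d) → ℝ)
    (g : EuclideanSpace ℝ (Fin d) → Ξ → EuclideanSpace ℝ (Fin d))
    (P : Measure Ω) (ξ : Ω → Ξ) (σ : ℝ) : Prop :=
  ∀ x, (σ = 0 → ∀ᵐ ω ∂P, g x (ξ ω) = gradient f x) ∧
    (σ ≠ 0 →
      ∫⁻ ω, ENNReal.ofReal (Real.exp (‖gradient f x - g x (ξ ω)‖ ^ 2 / σ ^ 2)) ∂P
        ≤ ENNReal.ofReal (Real.exp 1))

/-- State of the algorithm after `t` completed steps: the current point `x_{t+1}`, the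
momentum `m_t`, and the coordinate-wise sums of squares `∑_{i ≤ t} g_{i,j}²`. -/
structure State (d : ℕ) where
  x : EuclideanSpace ℝ (Fin d)
  m : EuclideanSpace ℝ (Fin d)
  sumSq : Fin d → ℝ

/-- Delayed AdaGrad step sizes `η_j = α / √(β + ∑_{past i} g_{i,j}²)`, for the next step. -/
def stepSize {d : ℕ} (α β : ℝ) (S : State d) (j : Fin d) : ℝ :=
  α / √(β + S.sumSq j)

/-- One step of the momentum algorithm when the oracle returns `G` at the current point:
`m_t = μ m_{t-1} + η_t g_t` (coordinate-wise product) and `x_{t+1} = x_t - m_t`. -/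
def step {d : ℕ} (α β μ : ℝ) (S : State d) (G : EuclideanSpace ℝ (Fin d)) : State d where
  x := S.x - (μ • S.m + WithLp.toLp 2 fun j => stepSize α β S j * G j)
  m := μ • S.m + WithLp.toLp 2 fun j => stepSize α β S j * G j
  sumSq := fun j => S.sumSq j + G j ^ 2

/-- The run of the algorithm from `x₁` with zero initial momentum, along the seeds
`s 0, s 1, …` (the seed of step `t + 1` is `s t`). -/
def run {d : ℕ} {Ξ : Type*}
    (g : EuclideanSpace ℝ (Fin d) → Ξ → EuclideanSpace ℝ (Fin d))
    (α β μ : ℝ) (x₁ : EuclideanSpace ℝ (Fin d)) (s : ℕ → Ξ) : ℕ → State d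
  | 0 => ⟨x₁, 0, 0⟩
  | t + 1 => step α β μ (run g α β μ x₁ s t) (g (run g α β μ x₁ s t).x (s t))

/-- The point at which the `(t + 1)`-st stochastic gradient is queried;
`iterate … 0 = x₁` is the initial point. -/
def iterate {d : ℕ} {Ξ : Type*}
    (g : EuclideanSpace ℝ (Fin d) → Ξ → EuclideanSpace ℝ (Fin d))
    (α β μ : ℝ) (x₁ : EuclideanSpace ℝ (Fin d)) (s : ℕ → Ξ) (t : ℕ) :
    EuclideanSpace ℝ (Fin d) :=
  (run g α β μ x₁ s t).x

/-- The step sizes of the run are `α / √(β + ∑_{i < t} g_{i,j}²)`. -/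
theorem stepSize_run {d : ℕ} {Ξ : Type*}
    (g : EuclideanSpace ℝ (Fin d) → Ξ → EuclideanSpace ℝ (Fin d))
    (α β μ : ℝ) (x₁ : EuclideanSpace ℝ (Fin d)) (s : ℕ → Ξ) (t : ℕ) (j : Fin d) :
    stepSize α β (run g α β μ x₁ s t) j =
      α / √(β + ∑ i ∈ Finset.range t, g (iterate g α β μ x₁ s i) (s i) j ^ 2) := by
  have h : ∀ t, (run g α β μ x₁ s t).sumSq j =
      ∑ i ∈ Finset.range t, g (iterate g α β μ x₁ s i) (s i) j ^ 2 := by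
    intro t
    induction t with
    | zero => rfl
    | succ t ih => rw [Finset.sum_range_succ, ← ih]; rfl
  rw [stepSize, h]

/-- `C(T) = c (1/α + d (α + σ² (α ln(T/δ) + ln(1/δ)/(1-μ))) / (1-μ))`. -/
def constC (c α μ σ δ : ℝ) (d T : ℕ) : ℝ :=
  c * (1 / α +
    d * (α + σ ^ 2 * (α * Real.log (T / δ) + Real.log (1 / δ) / (1 - μ))) / (1 - μ))

end DelayedAdaGrad

end

/-!
Extrapolating the iterates to `z_t = x_t - μ / (1 - μ) m_{t-1}` turns the momentum method into a
plain gradient method, `z_{t+1} = z_t - η_t g_t / (1 - μ)`. The descent lemma at `z_t`, with a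
multiple of `‖m‖²` added to the potential to absorb `∇f(z_t) - ∇f(x_t)`, gives
(`IsSmooth.momentum_step`, `sum_inner_step_le`)

`∑ ⟨∇f(x_t), η_t g_t⟩ ≤ f(x₁) - f⋆ + K ∑ ‖η_t g_t‖²`, with `K = M (1 + μ) / (2 (1 - μ)²)`,

and the condition on the step size says `K α ≤ √β / 16`. Write `S = ∑_t ∑_j η_{t,j} (∂_j f(x_t))²`
for the progress and `n_t = ∇f(x_t) - g_t` for the noise. Two error terms have to be
dominated by a fraction of `S`, which leaves an explicit bound on `S` (`progress_le`).

* `K ∑ ‖η_t g_t‖²` is treated one coordinate at a time (`sum_eta_sq_mul_sq_le`). With `η_{t+1}` in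
  place of the delayed `η_t` the sum is at most `α² ln (1 + ∑ g² / β)`; the difference
  `(η_t² - η_{t+1}²) g_t²` telescopes on the noise part of `g_t` and is a small multiple of `S` on
  the gradient part. The logarithm is again at most a multiple of `S` plus a logarithm of the
  accumulated noise, because `ln (1 + u) ≤ u / √(1 + u)`.
* `∑ ⟨η_t ∇f(x_t), n_t⟩` is a martingale, since the delayed `η_t` is known before `g_t` is drawn.
  The noise is conditionally sub-Gaussian (`lintegral_exp_inner_le_one`), so the exponential
  supermartingale (`lintegral_exp_sum_le_one`) and Markov's inequality bound the sum by its
  predictable variation plus a logarithm of the confidence level. That variation is at most a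
  multiple of `S`, as `η_t² ≤ (α / √β) η_t`.

A union bound makes all `‖n_t‖²` at most `σ² ln (3 T e / δ)`. On the resulting event `S ≤ C(T)`
when `T ≥ 2` (`bound_le_constC`), and since every step size is at least `α / √(β + ∑ ‖g_t‖²)`, the
sum `Y = ∑ ‖∇f(x_t)‖²` satisfies `α Y ≤ C √(β + 2 T max ‖n_t‖² + 2 Y)`, which is solved for `Y`
in `le_max_of_mul_le_mul_sqrt`. For `T = 1` the quantity `ln (T / δ)` can be arbitrarily small, but
then the claim follows from `‖∇f(x₁)‖² ≤ 2 M (f(x₁) - f⋆)` (`two_mul_le_constC_sq`).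
-/

namespace DelayedAdaGrad

/-! ### Smooth functions and the momentum step -/

/-- The descent lemma. -/
theorem IsSmooth.le_add {d : ℕ} {M : ℝ} {f : EuclideanSpace ℝ (Fin d) → ℝ} (hf : IsSmooth M f)
    (x v : EuclideanSpace ℝ (Fin d)) :
    f (x + v) ≤ f x + inner ℝ (gradient f x) v + M / 2 * ‖v‖ ^ 2 := by
  have hd : ∀ t : ℝ, HasDerivAt
      (fun t : ℝ => f (x + t • v) - t * inner ℝ (gradient f x) v - M / 2 * t ^ 2 * ‖v‖ ^ 2)
      (inner ℝ (gradient f (x + t • v)) v - inner ℝ (gradient f x) v - M * t * ‖v‖ ^ 2) t := by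
    intro t
    have h1 : HasDerivAt (fun t : ℝ => x + t • v) v t := by
      simpa using ((hasDerivAt_id t).smul_const v).const_add x
    have h2 := (hf.1 (x + t • v)).hasGradientAt.hasFDerivAt.comp_hasDerivAt t h1
    simp only [InnerProductSpace.toDual_apply_apply] at h2
    have h3 := (hasDerivAt_id t).mul_const (inner ℝ (gradient f x) v)
    have h4 := (((hasDerivAt_id t).pow 2).const_mul (M / 2)).mul_const (‖v‖ ^ 2)
    refine ((h2.sub h3).sub h4).congr_deriv ?_
    simp only [id]
    push_cast
    ring
  have hanti : AntitoneOn
      (fun t : ℝ => f (x + t • v) - t * inner ℝ (gradient f x) v - M / 2 * t ^ 2 * ‖v‖ ^ 2)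
      (Set.Icc 0 1) := by
    refine antitoneOn_of_deriv_nonpos (convex_Icc 0 1)
      (fun t _ => (hd t).continuousAt.continuousWithinAt)
      (fun t _ => (hd t).differentiableAt.differentiableWithinAt) fun t ht => ?_
    rw [interior_Icc] at ht
    rw [(hd t).deriv, ← inner_sub_left]
    have h1 := real_inner_le_norm (gradient f (x + t • v) - gradient f x) v
    have h2 := hf.2 (x + t • v) x
    rw [add_sub_cancel_left, norm_smul, Real.norm_of_nonneg ht.1.le] at h2
    nlinarith [mul_le_mul_of_nonneg_right h2 (norm_nonneg v)]
  have := hanti (Set.left_mem_Icc.2 zero_le_one) (Set.right_mem_Icc.2 zero_le_one) zero_le_one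
  simp only [one_smul, zero_smul, add_zero] at this
  linarith

theorem IsSmooth.norm_gradient_sq_le {d : ℕ} {M : ℝ} {f : EuclideanSpace ℝ (Fin d) → ℝ}
    (hf : IsSmooth M f) (hM : 0 < M) (hb : BddBelow (Set.range f))
    (x : EuclideanSpace ℝ (Fin d)) :
    ‖gradient f x‖ ^ 2 ≤ 2 * M * (f x - ⨅ y, f y) := by
  have h1 := hf.le_add x (-(M⁻¹ • gradient f x))
  have h2 := ciInf_le hb (x + -(M⁻¹ • gradient f x))
  rw [inner_neg_right, real_inner_smul_right, real_inner_self_eq_norm_sq, norm_neg, norm_smul,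
    Real.norm_of_nonneg (inv_pos.2 hM).le] at h1
  have h3 : M / 2 * (M⁻¹ * ‖gradient f x‖) ^ 2 = M⁻¹ * ‖gradient f x‖ ^ 2 / 2 := by
    field_simp
  have h4 : M⁻¹ * ‖gradient f x‖ ^ 2 / 2 ≤ f x - ⨅ y, f y := by linarith
  have h5 : ‖gradient f x‖ ^ 2 = 2 * M * (M⁻¹ * ‖gradient f x‖ ^ 2 / 2) := by field_simp
  rw [h5]
  gcongr

/-- One step of the momentum method, seen at the extrapolated point `x - μ / (1 - μ) m`, which
moves by `-u / (1 - μ)`. The kinetic term `‖m‖²` absorbs the gap between the gradients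
at `x` and at the extrapolated point. -/
theorem IsSmooth.momentum_step {d : ℕ} {M : ℝ} {f : EuclideanSpace ℝ (Fin d) → ℝ}
    (hf : IsSmooth M f) (hM : 0 < M) {μ : ℝ} (hμ0 : 0 ≤ μ) (hμ1 : μ < 1)
    (x m u : EuclideanSpace ℝ (Fin d)) :
    (1 - μ) * f (x - (μ • m + u) - (μ / (1 - μ)) • (μ • m + u)) +
        M * μ / (2 * (1 - μ)) * ‖μ • m + u‖ ^ 2 ≤
      (1 - μ) * f (x - (μ / (1 - μ)) • m) + M * μ / (2 * (1 - μ)) * ‖m‖ ^ 2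
        - inner ℝ (gradient f x) u + M * (1 + μ) / (2 * (1 - μ) ^ 2) * ‖u‖ ^ 2 := by
  have hp : 0 < 1 - μ := by linarith
  set z := x - (μ / (1 - μ)) • m with hz
  have hz' : x - (μ • m + u) - (μ / (1 - μ)) • (μ • m + u) = z + (-(1 / (1 - μ))) • u := by
    have h1 : μ / (1 - μ) = μ + μ / (1 - μ) * μ := by field_simp; ring
    have h2 : 1 / (1 - μ) = 1 + μ / (1 - μ) := by field_simp; ring
    rw [hz, h2]
    have h3 : (μ / (1 - μ)) • m = (μ + μ / (1 - μ) * μ) • m := by rw [← h1]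
    rw [h3]
    module
  rw [hz']
  have hd := hf.le_add z ((-(1 / (1 - μ))) • u)
  rw [real_inner_smul_right, norm_smul, mul_pow, Real.norm_eq_abs, sq_abs] at hd
  have hgap : -inner ℝ (gradient f z) u ≤ -inner ℝ (gradient f x) u +
      M * (μ / (1 - μ) * ‖m‖) * ‖u‖ := by
    have h1 := real_inner_le_norm (gradient f x - gradient f z) u
    have h2 := hf.2 x z
    rw [hz, sub_sub_cancel, norm_smul, Real.norm_of_nonneg (by positivity), ← hz] at h2
    rw [inner_sub_left] at h1
    nlinarith [mul_le_mul_of_nonneg_right h2 (norm_nonneg u)]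
  have hconv : ‖μ • m + u‖ ^ 2 ≤ μ * ‖m‖ ^ 2 + ‖u‖ ^ 2 / (1 - μ) := by
    have h1 : ‖μ • m + u‖ ≤ μ * ‖m‖ + ‖u‖ := by
      simpa [norm_smul, abs_of_nonneg hμ0] using norm_add_le (μ • m) u
    have h2 : ‖μ • m + u‖ ^ 2 ≤ (μ * ‖m‖ + ‖u‖) ^ 2 := by gcongr
    have h3 : μ * ‖m‖ ^ 2 + ‖u‖ ^ 2 / (1 - μ) - (μ * ‖m‖ + ‖u‖) ^ 2 =
        μ / (1 - μ) * ((1 - μ) * ‖m‖ - ‖u‖) ^ 2 := by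
      field_simp; ring
    have h4 : 0 ≤ μ / (1 - μ) * ((1 - μ) * ‖m‖ - ‖u‖) ^ 2 := by positivity
    linarith
  have hkin := mul_le_mul_of_nonneg_left hconv
    (show 0 ≤ M * μ / (2 * (1 - μ)) by positivity)
  have hd' := mul_le_mul_of_nonneg_left hd hp.le
  have hyoung : M * (μ / (1 - μ) * ‖m‖) * ‖u‖ ≤
      M * μ / 2 * ‖m‖ ^ 2 + M * μ / (2 * (1 - μ) ^ 2) * ‖u‖ ^ 2 := by
    have h3 : M * μ / 2 * ‖m‖ ^ 2 + M * μ / (2 * (1 - μ) ^ 2) * ‖u‖ ^ 2 -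
        M * (μ / (1 - μ) * ‖m‖) * ‖u‖ = M * μ / 2 * (‖m‖ - ‖u‖ / (1 - μ)) ^ 2 := by
      field_simp; ring
    have h4 : 0 ≤ M * μ / 2 * (‖m‖ - ‖u‖ / (1 - μ)) ^ 2 := by positivity
    linarith
  have e1 : (1 - μ) * (f z + -(1 / (1 - μ)) * inner ℝ (gradient f z) u +
      M / 2 * ((-(1 / (1 - μ))) ^ 2 * ‖u‖ ^ 2)) =
      (1 - μ) * f z - inner ℝ (gradient f z) u + M / (2 * (1 - μ)) * ‖u‖ ^ 2 := by
    field_simp; ring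
  have e2 : M * μ / (2 * (1 - μ)) * (μ * ‖m‖ ^ 2 + ‖u‖ ^ 2 / (1 - μ)) +
      (M * μ / 2 * ‖m‖ ^ 2 + M * μ / (2 * (1 - μ) ^ 2) * ‖u‖ ^ 2) +
      M / (2 * (1 - μ)) * ‖u‖ ^ 2 =
      M * μ / (2 * (1 - μ)) * ‖m‖ ^ 2 + M * (1 + μ) / (2 * (1 - μ) ^ 2) * ‖u‖ ^ 2 := by
    field_simp; ring
  rw [e1] at hd'
  linarith

/-! ### AdaGrad sums along one coordinate -/

theorem log_le_div_sqrt {u : ℝ} (hu : 0 ≤ u) : Real.log (1 + u) ≤ u / √(1 + u) := by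
  -- with `1 + u = exp (2 s)`, this is `s ≤ sinh s`
  set s := Real.log (1 + u) / 2 with hs
  have hs0 : 0 ≤ s := by have := Real.log_nonneg (show 1 ≤ 1 + u by linarith); positivity
  have hsq : √(1 + u) = Real.exp s := by
    rw [hs, Real.exp_half, Real.exp_log (by linarith)]
  have hu' : u = Real.exp s ^ 2 - 1 := by
    rw [← hsq, Real.sq_sqrt (by linarith)]; ring
  have h1 := Real.self_le_sinh_iff.2 hs0
  rw [Real.sinh_eq, Real.exp_neg] at h1
  have h2 : u / √(1 + u) = Real.exp s - (Real.exp s)⁻¹ := by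
    rw [hsq, hu']; field_simp
  rw [h2]
  linarith

/-- The delayed AdaGrad step size after the squared gradients `G 0 ^ 2, …, G (t - 1) ^ 2`. -/
noncomputable def eta (α β : ℝ) (G : ℕ → ℝ) (t : ℕ) : ℝ :=
  α / √(β + ∑ i ∈ Finset.range t, G i ^ 2)

theorem add_sum_sq_pos {β : ℝ} (hβ : 0 < β) (G : ℕ → ℝ) (t : ℕ) :
    0 < β + ∑ i ∈ Finset.range t, G i ^ 2 := by
  have : 0 ≤ ∑ i ∈ Finset.range t, G i ^ 2 := Finset.sum_nonneg fun _ _ => sq_nonneg _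
  linarith

theorem eta_pos {α β : ℝ} (hα : 0 < α) (hβ : 0 < β) (G : ℕ → ℝ) (t : ℕ) : 0 < eta α β G t :=
  div_pos hα (Real.sqrt_pos.2 (add_sum_sq_pos hβ G t))

theorem eta_sq {α β : ℝ} (hβ : 0 < β) (G : ℕ → ℝ) (t : ℕ) :
    eta α β G t ^ 2 = α ^ 2 / (β + ∑ i ∈ Finset.range t, G i ^ 2) := by
  rw [eta, div_pow, Real.sq_sqrt (add_sum_sq_pos hβ G t).le]

theorem eta_anti {α β : ℝ} (hα : 0 < α) (hβ : 0 < β) (G : ℕ → ℝ) : Antitone (eta α β G) := by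
  refine antitone_nat_of_succ_le fun t => ?_
  refine div_le_div_of_nonneg_left hα.le (Real.sqrt_pos.2 (add_sum_sq_pos hβ G t))
    (Real.sqrt_le_sqrt ?_)
  rw [Finset.sum_range_succ]
  nlinarith [sq_nonneg (G t)]

theorem eta_le {α β : ℝ} (hα : 0 < α) (hβ : 0 < β) (G : ℕ → ℝ) (t : ℕ) :
    eta α β G t ≤ α / √β := by
  simpa [eta] using eta_anti hα hβ G (Nat.zero_le t)

/-- Replacing `η_t` by `η_{t+1}` makes the sum of the `η² G²` logarithmic. The price
`(η_t² - η_{t+1}²) G_t²` telescopes on the noise part of `G_t` and is a small multiple of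
`η_t D_t²` on the rest. -/
theorem sum_eta_sq_mul_sq_le_log {α β : ℝ} (hα : 0 < α) (hβ : 0 < β) (G D : ℕ → ℝ) {N : ℝ}
    (T : ℕ) (h : ∀ t < T, (D t - G t) ^ 2 ≤ N) :
    ∑ t ∈ Finset.range T, eta α β G t ^ 2 * G t ^ 2 ≤
      2 * (α / √β) * ∑ t ∈ Finset.range T, eta α β G t * D t ^ 2 +
        2 * N * (α ^ 2 / β - eta α β G T ^ 2) +
        α ^ 2 * Real.log ((β + ∑ t ∈ Finset.range T, G t ^ 2) / β) := by
  induction T with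
  | zero => simp [eta_sq hβ, hβ.ne']
  | succ T ih =>
    have ih' := ih fun t ht => h t (by omega)
    have hn := h T (by omega)
    have hp := add_sum_sq_pos hβ G T
    have hq := add_sum_sq_pos hβ G (T + 1)
    have hη := eta_pos hα hβ G T
    have hpq : β + ∑ i ∈ Finset.range (T + 1), G i ^ 2 =
        (β + ∑ i ∈ Finset.range T, G i ^ 2) + G T ^ 2 := by
      rw [Finset.sum_range_succ]; ring
    have hsq := eta_sq (α := α) hβ G T
    have hsq' := eta_sq (α := α) hβ G (T + 1)
    have hanti : eta α β G (T + 1) ^ 2 ≤ eta α β G T ^ 2 := by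
      have := eta_anti hα hβ G (Nat.le_succ T)
      have := (eta_pos hα hβ G (T + 1)).le
      gcongr
    set p := β + ∑ i ∈ Finset.range T, G i ^ 2
    set q := β + ∑ i ∈ Finset.range (T + 1), G i ^ 2
    have hlog : Real.log (q / β) = Real.log (p / β) + Real.log (q / p) := by
      rw [← Real.log_mul (by positivity) (by positivity)]
      congr 1
      field_simp
    have h1 : eta α β G (T + 1) ^ 2 * G T ^ 2 ≤ α ^ 2 * Real.log (q / p) := by
      have h2 := Real.one_sub_inv_le_log_of_pos (show 0 < q / p by positivity)
      have h3 : eta α β G (T + 1) ^ 2 * G T ^ 2 = α ^ 2 * (1 - (q / p)⁻¹) := by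
        rw [hsq', show G T ^ 2 = q - p by linarith]
        field_simp
      rw [h3]
      gcongr
    have h2 : (eta α β G T ^ 2 - eta α β G (T + 1) ^ 2) * G T ^ 2 ≤
        2 * (eta α β G T ^ 2 * D T ^ 2) +
          2 * N * (eta α β G T ^ 2 - eta α β G (T + 1) ^ 2) := by
      have h3 : G T ^ 2 ≤ 2 * D T ^ 2 + 2 * N := by nlinarith [sq_nonneg (2 * D T - G T)]
      have h4 := mul_le_mul_of_nonneg_left h3 (sub_nonneg.2 hanti)
      have h5 : 0 ≤ eta α β G (T + 1) ^ 2 * D T ^ 2 := by positivity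
      nlinarith
    have h3 : eta α β G T ^ 2 * D T ^ 2 ≤ α / √β * (eta α β G T * D T ^ 2) := by
      rw [← mul_assoc, sq (eta α β G T)]
      have := eta_le hα hβ G T
      gcongr
    rw [Finset.sum_range_succ, Finset.sum_range_succ (fun t => eta α β G t * D t ^ 2), hlog]
    linarith

theorem eta_mul_sum_le {α β : ℝ} (hα : 0 < α) (hβ : 0 < β) (G D : ℕ → ℝ) (T : ℕ) :
    eta α β G T * ∑ t ∈ Finset.range T, D t ^ 2 ≤
      ∑ t ∈ Finset.range T, eta α β G t * D t ^ 2 := by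
  rw [Finset.mul_sum]
  refine Finset.sum_le_sum fun t ht => ?_
  have := eta_anti hα hβ G (Finset.mem_range.1 ht).le
  gcongr

theorem sum_sq_le_of_noise_le (G D : ℕ → ℝ) {N : ℝ} (T : ℕ)
    (h : ∀ t < T, (D t - G t) ^ 2 ≤ N) :
    ∑ t ∈ Finset.range T, G t ^ 2 ≤ 2 * ∑ t ∈ Finset.range T, D t ^ 2 + 2 * (T * N) := by
  have : ∑ t ∈ Finset.range T, G t ^ 2 ≤ ∑ t ∈ Finset.range T, (2 * D t ^ 2 + 2 * N) := by
    refine Finset.sum_le_sum fun t ht => ?_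
    have := h t (Finset.mem_range.1 ht)
    nlinarith [sq_nonneg (2 * D t - G t)]
  rw [Finset.sum_add_distrib, ← Finset.mul_sum] at this
  simp only [Finset.sum_const, Finset.card_range, nsmul_eq_mul] at this
  linarith

/-- The logarithm of the accumulated squares is paid for by `∑ η_t D_t²` when the signal
dominates, and is at most that of the noise otherwise. -/
theorem log_sum_sq_le {α β : ℝ} (hα : 0 < α) (hβ : 0 < β) (G D : ℕ → ℝ) {N : ℝ}
    (hN : 0 ≤ N) (T : ℕ) (h : ∀ t < T, (D t - G t) ^ 2 ≤ N) :
    α * √β * Real.log ((β + ∑ t ∈ Finset.range T, G t ^ 2) / β) ≤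
      4 * ∑ t ∈ Finset.range T, eta α β G t * D t ^ 2 +
        α * √β * Real.log (1 + 4 * T * N / β) := by
  have hA := sum_sq_le_of_noise_le G D T h
  have hA0 := add_sum_sq_pos hβ G T
  have hQ := eta_mul_sum_le hα hβ G D T
  have hY : 0 ≤ ∑ t ∈ Finset.range T, D t ^ 2 := Finset.sum_nonneg fun _ _ => sq_nonneg _
  have hsβ : 0 < √β := Real.sqrt_pos.2 hβ
  rw [eta] at hQ
  set Y := ∑ t ∈ Finset.range T, D t ^ 2
  set A := ∑ t ∈ Finset.range T, G t ^ 2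
  set Q := ∑ t ∈ Finset.range T, eta α β G t * D t ^ 2
  have hQ0 : 0 ≤ Q := le_trans (by positivity) hQ
  have hTN : 0 ≤ T * N := by positivity
  have hlogN : 0 ≤ Real.log (1 + 4 * T * N / β) :=
    Real.log_nonneg (by have : 0 ≤ 4 * T * N / β := by positivity
                        linarith)
  rcases le_total Y (T * N) with hc | hc
  · have h1 : Real.log ((β + A) / β) ≤ Real.log (1 + 4 * T * N / β) := by
      refine Real.log_le_log (by positivity) ?_
      rw [add_div, div_self hβ.ne']
      gcongr
      linarith
    have := mul_le_mul_of_nonneg_left h1 (show 0 ≤ α * √β by positivity)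
    linarith
  · have h1 : Real.log ((β + A) / β) ≤ Real.log (1 + 4 * Y / β) := by
      refine Real.log_le_log (by positivity) ?_
      rw [add_div, div_self hβ.ne']
      gcongr
      linarith
    have h2 := log_le_div_sqrt (show 0 ≤ 4 * Y / β by positivity)
    have h3 : α * √β * ((4 * Y / β) / √(1 + 4 * Y / β)) = 4 * (α / √(β + 4 * Y) * Y) := by
      have h4 : √(β + 4 * Y) = √β * √(1 + 4 * Y / β) := by
        rw [← Real.sqrt_mul hβ.le]
        congr 1
        field_simp
      have h5 : 0 < √(1 + 4 * Y / β) := Real.sqrt_pos.2 (by positivity)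
      rw [h4]
      field_simp
      rw [Real.sq_sqrt hβ.le, mul_comm]
    have h4 : α / √(β + 4 * Y) * Y ≤ α / √(β + A) * Y := by
      have : 0 < √(β + A) := Real.sqrt_pos.2 hA0
      gcongr
      linarith
    have := mul_le_mul_of_nonneg_left (h1.trans h2) (show 0 ≤ α * √β by positivity)
    have : 0 ≤ α * √β * Real.log (1 + 4 * T * N / β) := by positivity
    linarith

/-- The squared steps of one coordinate cost at most `3 / 8` of its progress, up to a logarithm of
the noise and a single multiple of the noise bound. -/
theorem sum_eta_sq_mul_sq_le {α β K : ℝ} (hα : 0 < α) (hβ : 0 < β) (hK : 0 ≤ K)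
    (hKα : K * α ≤ √β / 16) (G D : ℕ → ℝ) {N : ℝ}
    (hN : 0 ≤ N) (T : ℕ) (h : ∀ t < T, (D t - G t) ^ 2 ≤ N) :
    K * ∑ t ∈ Finset.range T, eta α β G t ^ 2 * G t ^ 2 ≤
      3 / 8 * ∑ t ∈ Finset.range T, eta α β G t * D t ^ 2 +
        α * √β / 16 * Real.log (1 + 4 * T * N / β) + α / (8 * √β) * N := by
  have h1 := mul_le_mul_of_nonneg_left (sum_eta_sq_mul_sq_le_log hα hβ G D T h) hK
  have h2 := log_sum_sq_le hα hβ G D hN T h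
  have hsβ : 0 < √β := Real.sqrt_pos.2 hβ
  have hss : √β * √β = β := Real.mul_self_sqrt hβ.le
  have hA0 : 0 ≤ ∑ t ∈ Finset.range T, G t ^ 2 := Finset.sum_nonneg fun _ _ => sq_nonneg _
  have hQ0 : 0 ≤ ∑ t ∈ Finset.range T, eta α β G t * D t ^ 2 :=
    Finset.sum_nonneg fun t _ => mul_nonneg (eta_pos hα hβ G t).le (sq_nonneg _)
  have hlog : 0 ≤ Real.log ((β + ∑ t ∈ Finset.range T, G t ^ 2) / β) :=
    Real.log_nonneg (by rw [le_div_iff₀ hβ]; linarith)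
  have h3 : K * (2 * (α / √β) * ∑ t ∈ Finset.range T, eta α β G t * D t ^ 2) ≤
      1 / 8 * ∑ t ∈ Finset.range T, eta α β G t * D t ^ 2 := by
    rw [← mul_assoc]
    gcongr
    calc K * (2 * (α / √β)) = 2 * (K * α) / √β := by ring
      _ ≤ 2 * (√β / 16) / √β := by gcongr
      _ = 1 / 8 := by field_simp; norm_num
  have h4 : K * (2 * N * (α ^ 2 / β - eta α β G T ^ 2)) ≤ α / (8 * √β) * N := by
    have h5 : K * (2 * N * (α ^ 2 / β - eta α β G T ^ 2)) ≤ K * (2 * N * (α ^ 2 / β)) := by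
      gcongr
      linarith [sq_nonneg (eta α β G T)]
    have h6 : K * (2 * N * (α ^ 2 / β)) = 2 * (K * α) * N * α / β := by ring
    have h7 : 2 * (K * α) * N * α / β ≤ 2 * (√β / 16) * N * α / β := by gcongr
    have h8 : 2 * (√β / 16) * N * α / β = α / (8 * √β) * N := by
      rw [div_mul_eq_mul_div, div_eq_div_iff (by positivity) (by positivity)]
      linear_combination N * α * hss
    linarith
  have h5 : K * (α ^ 2 * Real.log ((β + ∑ t ∈ Finset.range T, G t ^ 2) / β)) ≤
      α * √β / 16 * Real.log ((β + ∑ t ∈ Finset.range T, G t ^ 2) / β) := by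
    rw [← mul_assoc]
    gcongr
    nlinarith
  linarith

/-! ### The run along a fixed seed sequence -/

section Pathwise

variable {d : ℕ} {Ξ : Type*} (f : EuclideanSpace ℝ (Fin d) → ℝ)
  (g : EuclideanSpace ℝ (Fin d) → Ξ → EuclideanSpace ℝ (Fin d)) (α β μ : ℝ)
  (x₁ : EuclideanSpace ℝ (Fin d)) (s : ℕ → Ξ)

/-- The stochastic gradient `g(x_t, ξ_t)` returned along the run. -/
noncomputable def oracle (t : ℕ) : EuclideanSpace ℝ (Fin d) := g (iterate g α β μ x₁ s t) (s t)

/-- The noise `∇f(x_t) - g(x_t, ξ_t)` of the oracle along the run. -/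
noncomputable def noise (t : ℕ) : EuclideanSpace ℝ (Fin d) :=
  gradient f (iterate g α β μ x₁ s t) - oracle g α β μ x₁ s t

/-- The true gradient scaled by the step sizes, `η_t ∇f(x_t)`. Unlike `η_t g_t`, it is determined
by the seeds of the previous steps. -/
noncomputable def scaledGradient (t : ℕ) : EuclideanSpace ℝ (Fin d) :=
  WithLp.toLp 2 fun j => stepSize α β (run g α β μ x₁ s t) j *
    gradient f (iterate g α β μ x₁ s t) j

/-- The progress `∑_{t < T} ∑_j η_{t,j} (∂_j f(x_t))²` of the run. -/
noncomputable def progress (T : ℕ) : ℝ :=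
  ∑ t ∈ Finset.range T, inner ℝ (scaledGradient f g α β μ x₁ s t)
    (gradient f (iterate g α β μ x₁ s t))

variable {f g α β μ x₁ s}

theorem stepSize_run_eq_eta (t : ℕ) (j : Fin d) :
    stepSize α β (run g α β μ x₁ s t) j = eta α β (fun i => oracle g α β μ x₁ s i j) t :=
  stepSize_run g α β μ x₁ s t j

theorem inner_scaledGradient (t : ℕ) (w : EuclideanSpace ℝ (Fin d)) :
    inner ℝ (scaledGradient f g α β μ x₁ s t) w =
      ∑ j, eta α β (fun i => oracle g α β μ x₁ s i j) t *
        (gradient f (iterate g α β μ x₁ s t) j * w j) := by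
  rw [PiLp.inner_apply]
  refine Finset.sum_congr rfl fun j _ => ?_
  rw [← stepSize_run_eq_eta]
  simp [scaledGradient]
  ring

theorem progress_eq (T : ℕ) : progress f g α β μ x₁ s T =
    ∑ j, ∑ t ∈ Finset.range T, eta α β (fun i => oracle g α β μ x₁ s i j) t *
      gradient f (iterate g α β μ x₁ s t) j ^ 2 := by
  rw [Finset.sum_comm, progress]
  refine Finset.sum_congr rfl fun t _ => ?_
  rw [inner_scaledGradient]
  exact Finset.sum_congr rfl fun j _ => by rw [sq]

theorem norm_scaledGradient_sq_le (hα : 0 < α) (hβ : 0 < β) (t : ℕ) :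
    ‖scaledGradient f g α β μ x₁ s t‖ ^ 2 ≤ α / √β *
      inner ℝ (scaledGradient f g α β μ x₁ s t) (gradient f (iterate g α β μ x₁ s t)) := by
  rw [inner_scaledGradient, EuclideanSpace.norm_sq_eq, Finset.mul_sum]
  refine Finset.sum_le_sum fun j _ => ?_
  have h1 := eta_le hα hβ (fun i => oracle g α β μ x₁ s i j) t
  have h2 := eta_pos hα hβ (fun i => oracle g α β μ x₁ s i j) t
  simp only [scaledGradient, stepSize_run_eq_eta, Real.norm_eq_abs, sq_abs, mul_pow]
  rw [sq (eta _ _ _ _), ← sq ((gradient f (iterate g α β μ x₁ s t)) j), mul_assoc]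
  gcongr

/-- The descent inequality summed along the run: the momentum costs nothing beyond the factor
`M (1 + μ) / (2 (1 - μ)²)` of the squared steps. -/
theorem sum_inner_step_le {M : ℝ} (hf : IsSmooth M f) (hb : BddBelow (Set.range f))
    (hM : 0 < M) (hμ0 : 0 ≤ μ) (hμ1 : μ < 1) (T : ℕ) :
    ∑ t ∈ Finset.range T, inner ℝ (scaledGradient f g α β μ x₁ s t) (oracle g α β μ x₁ s t) ≤
      (f x₁ - ⨅ x, f x) + M * (1 + μ) / (2 * (1 - μ) ^ 2) *
        ∑ j, ∑ t ∈ Finset.range T, eta α β (fun i => oracle g α β μ x₁ s i j) t ^ 2 *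
          oracle g α β μ x₁ s t j ^ 2 := by
  have hp : 0 < 1 - μ := by linarith
  have key : ∀ T,
      (1 - μ) * f ((run g α β μ x₁ s T).x - (μ / (1 - μ)) • (run g α β μ x₁ s T).m) +
        M * μ / (2 * (1 - μ)) * ‖(run g α β μ x₁ s T).m‖ ^ 2 +
        ∑ t ∈ Finset.range T, inner ℝ (scaledGradient f g α β μ x₁ s t)
          (oracle g α β μ x₁ s t) ≤
      (1 - μ) * f x₁ + M * (1 + μ) / (2 * (1 - μ) ^ 2) *
        ∑ t ∈ Finset.range T, ∑ j, eta α β (fun i => oracle g α β μ x₁ s i j) t ^ 2 *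
          oracle g α β μ x₁ s t j ^ 2 := by
    intro T
    induction T with
    | zero => simp [run]
    | succ T ih =>
      have h := hf.momentum_step hM hμ0 hμ1 (run g α β μ x₁ s T).x (run g α β μ x₁ s T).m
        (WithLp.toLp 2 fun j => stepSize α β (run g α β μ x₁ s T) j * oracle g α β μ x₁ s T j)
      have h1 : inner ℝ (gradient f (run g α β μ x₁ s T).x)
          (WithLp.toLp 2 fun j =>
            stepSize α β (run g α β μ x₁ s T) j * oracle g α β μ x₁ s T j) =
          inner ℝ (scaledGradient f g α β μ x₁ s T) (oracle g α β μ x₁ s T) := by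
        rw [inner_scaledGradient, PiLp.inner_apply]
        refine Finset.sum_congr rfl fun j _ => ?_
        rw [← stepSize_run_eq_eta]
        simp [iterate]
        ring
      have h2 : ‖(WithLp.toLp 2 fun j =>
            stepSize α β (run g α β μ x₁ s T) j * oracle g α β μ x₁ s T j :
            EuclideanSpace ℝ (Fin d))‖ ^ 2 =
          ∑ j, eta α β (fun i => oracle g α β μ x₁ s i j) T ^ 2 *
          oracle g α β μ x₁ s T j ^ 2 := by
        rw [EuclideanSpace.norm_sq_eq]
        refine Finset.sum_congr rfl fun j _ => ?_
        rw [← stepSize_run_eq_eta]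
        simp [mul_pow]
      rw [h1, h2] at h
      rw [Finset.sum_range_succ, Finset.sum_range_succ (fun t => ∑ j, _), mul_add]
      change (1 - μ) * f ((run g α β μ x₁ s T).x - (μ • (run g α β μ x₁ s T).m +
        (WithLp.toLp 2 fun j => stepSize α β (run g α β μ x₁ s T) j *
          oracle g α β μ x₁ s T j)) - (μ / (1 - μ)) • (μ • (run g α β μ x₁ s T).m +
        (WithLp.toLp 2 fun j => stepSize α β (run g α β μ x₁ s T) j *
          oracle g α β μ x₁ s T j))) + M * μ / (2 * (1 - μ)) * ‖μ • (run g α β μ x₁ s T).m +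
        (WithLp.toLp 2 fun j => stepSize α β (run g α β μ x₁ s T) j *
          oracle g α β μ x₁ s T j)‖ ^ 2 + _ ≤ _
      linarith
  have h := key T
  rw [Finset.sum_comm] at h
  have h1 := mul_le_mul_of_nonneg_left
    (ciInf_le hb ((run g α β μ x₁ s T).x - (μ / (1 - μ)) • (run g α β μ x₁ s T).m)) hp.le
  have h2 : 0 ≤ M * μ / (2 * (1 - μ)) * ‖(run g α β μ x₁ s T).m‖ ^ 2 := by positivity
  have h3 : 0 ≤ μ * (f x₁ - ⨅ x, f x) := mul_nonneg hμ0 (sub_nonneg.2 (ciInf_le hb x₁))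
  linarith

theorem noise_apply_sq_le {N : ℝ} {t : ℕ} (hn : ‖noise f g α β μ x₁ s t‖ ^ 2 ≤ N) (j : Fin d) :
    (gradient f (iterate g α β μ x₁ s t) j - oracle g α β μ x₁ s t j) ^ 2 ≤ N := by
  refine le_trans ?_ hn
  rw [EuclideanSpace.norm_sq_eq]
  refine le_trans ?_ (Finset.single_le_sum (f := fun j => ‖noise f g α β μ x₁ s t j‖ ^ 2)
    (fun _ _ => by positivity) (Finset.mem_univ j))
  simp [noise]

/-- The pathwise bound on the progress, given a bound `N` on the squared noise and control of the
martingale `∑ ⟨η_t ∇f(x_t), noise_t⟩` by a quarter of the progress. -/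
theorem progress_le {M N B : ℝ} (hf : IsSmooth M f) (hb : BddBelow (Set.range f))
    (hM : 0 < M) (hα : 0 < α) (hβ : 0 < β) (hμ0 : 0 ≤ μ) (hμ1 : μ < 1)
    (hαμ : 4 * α ≤ √β * (1 - μ) ^ 2 / (2 * M * (1 + μ))) (hN : 0 ≤ N) (T : ℕ)
    (hn : ∀ t < T, ‖noise f g α β μ x₁ s t‖ ^ 2 ≤ N)
    (hZ : ∑ t ∈ Finset.range T, inner ℝ (scaledGradient f g α β μ x₁ s t)
        (noise f g α β μ x₁ s t) ≤ progress f g α β μ x₁ s T / 4 + B) :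
    progress f g α β μ x₁ s T ≤ 8 / 3 * ((f x₁ - ⨅ x, f x) + B +
      d * (α * √β / 16 * Real.log (1 + 4 * T * N / β) + α / (8 * √β) * N)) := by
  have hp : 0 < 1 - μ := by linarith
  have hK : M * (1 + μ) / (2 * (1 - μ) ^ 2) * α ≤ √β / 16 := by
    rw [le_div_iff₀ (by positivity)] at hαμ
    rw [div_mul_eq_mul_div, div_le_div_iff₀ (by positivity) (by positivity)]
    linarith
  have hsplit : progress f g α β μ x₁ s T =
      ∑ t ∈ Finset.range T, inner ℝ (scaledGradient f g α β μ x₁ s t)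
        (noise f g α β μ x₁ s t) +
      ∑ t ∈ Finset.range T, inner ℝ (scaledGradient f g α β μ x₁ s t)
        (oracle g α β μ x₁ s t) := by
    rw [progress, ← Finset.sum_add_distrib]
    refine Finset.sum_congr rfl fun t _ => ?_
    rw [← inner_add_right, noise, sub_add_cancel]
  have hstep := sum_inner_step_le (g := g) (α := α) (β := β) (x₁ := x₁) (s := s)
    hf hb hM hμ0 hμ1 T
  have hcoord : M * (1 + μ) / (2 * (1 - μ) ^ 2) *
      ∑ j, ∑ t ∈ Finset.range T, eta α β (fun i => oracle g α β μ x₁ s i j) t ^ 2 *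
          oracle g α β μ x₁ s t j ^ 2 ≤
      3 / 8 * progress f g α β μ x₁ s T +
        d * (α * √β / 16 * Real.log (1 + 4 * T * N / β) + α / (8 * √β) * N) := by
    rw [progress_eq, Finset.mul_sum, Finset.mul_sum]
    have hd : (d : ℝ) * (α * √β / 16 * Real.log (1 + 4 * T * N / β) + α / (8 * √β) * N) =
        ∑ _j : Fin d, (α * √β / 16 * Real.log (1 + 4 * T * N / β) + α / (8 * √β) * N) := by
      rw [Finset.sum_const, Finset.card_fin, nsmul_eq_mul]
    rw [hd, ← Finset.sum_add_distrib]
    refine Finset.sum_le_sum fun j _ => ?_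
    have := sum_eta_sq_mul_sq_le hα hβ (by positivity) hK
      (fun i => oracle g α β μ x₁ s i j) (fun t => gradient f (iterate g α β μ x₁ s t) j) hN T
      (fun t ht => noise_apply_sq_le (hn t ht) j)
    linarith
  linarith

/-- Every step size is at least `α / √(β + ∑ ‖g_t‖²)`. -/
theorem mul_sum_norm_sq_le_progress {N : ℝ} (hα : 0 < α) (hβ : 0 < β) (T : ℕ)
    (hn : ∀ t < T, ‖noise f g α β μ x₁ s t‖ ^ 2 ≤ N) :
    α * ∑ t ∈ Finset.range T, ‖gradient f (iterate g α β μ x₁ s t)‖ ^ 2 ≤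
      progress f g α β μ x₁ s T * √(β + 2 * (T * N) +
        2 * ∑ t ∈ Finset.range T, ‖gradient f (iterate g α β μ x₁ s t)‖ ^ 2) := by
  set Y := ∑ t ∈ Finset.range T, ‖gradient f (iterate g α β μ x₁ s t)‖ ^ 2 with hYdef
  have hY : Y = ∑ j, ∑ t ∈ Finset.range T, gradient f (iterate g α β μ x₁ s t) j ^ 2 := by
    rw [Finset.sum_comm]
    exact Finset.sum_congr rfl fun t _ => by simp [EuclideanSpace.norm_sq_eq]
  have hA : ∑ t ∈ Finset.range T, ‖oracle g α β μ x₁ s t‖ ^ 2 ≤ 2 * Y + 2 * (T * N) := by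
    have : ∑ t ∈ Finset.range T, ‖oracle g α β μ x₁ s t‖ ^ 2 ≤
        ∑ t ∈ Finset.range T, (2 * ‖gradient f (iterate g α β μ x₁ s t)‖ ^ 2 + 2 * N) := by
      refine Finset.sum_le_sum fun t ht => ?_
      have h1 := hn t (Finset.mem_range.1 ht)
      have h2 : ‖oracle g α β μ x₁ s t‖ ≤
          ‖gradient f (iterate g α β μ x₁ s t)‖ + ‖noise f g α β μ x₁ s t‖ := by
        have h3 : oracle g α β μ x₁ s t =
            gradient f (iterate g α β μ x₁ s t) - noise f g α β μ x₁ s t := by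
          rw [noise, sub_sub_cancel]
        rw [h3]
        exact norm_sub_le _ _
      have h3 : ‖oracle g α β μ x₁ s t‖ ^ 2 ≤
          (‖gradient f (iterate g α β μ x₁ s t)‖ + ‖noise f g α β μ x₁ s t‖) ^ 2 := by gcongr
      nlinarith [sq_nonneg (‖gradient f (iterate g α β μ x₁ s t)‖ - ‖noise f g α β μ x₁ s t‖)]
    rw [Finset.sum_add_distrib, ← Finset.mul_sum] at this
    simp only [Finset.sum_const, Finset.card_range, nsmul_eq_mul] at this
    linarith
  rcases Nat.eq_zero_or_pos T with rfl | hT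
  · simp [hYdef, progress]
  have hN : 0 ≤ N := le_trans (sq_nonneg _) (hn 0 hT)
  have hY0 : 0 ≤ Y := Finset.sum_nonneg fun _ _ => sq_nonneg _
  have hR : 0 < √(β + 2 * (T * N) + 2 * Y) := Real.sqrt_pos.2 (by positivity)
  have hQ : α / √(β + 2 * (T * N) + 2 * Y) * Y ≤ progress f g α β μ x₁ s T := by
    rw [hY, progress_eq, Finset.mul_sum, ← hY]
    refine Finset.sum_le_sum fun j _ => ?_
    refine le_trans ?_ (eta_mul_sum_le hα hβ _ _ T)
    have hpos := add_sum_sq_pos hβ (fun i => oracle g α β μ x₁ s i j) T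
    have h1 : ∑ t ∈ Finset.range T, oracle g α β μ x₁ s t j ^ 2 ≤
        ∑ t ∈ Finset.range T, ‖oracle g α β μ x₁ s t‖ ^ 2 := by
      refine Finset.sum_le_sum fun t _ => ?_
      rw [EuclideanSpace.norm_sq_eq]
      refine le_trans ?_ (Finset.single_le_sum (f := fun j => ‖oracle g α β μ x₁ s t j‖ ^ 2)
        (fun _ _ => by positivity) (Finset.mem_univ j))
      simp
    have hpos' : 0 < √(β + ∑ i ∈ Finset.range T, oracle g α β μ x₁ s i j ^ 2) :=
      Real.sqrt_pos.2 hpos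
    rw [eta]
    refine mul_le_mul_of_nonneg_right ?_ (Finset.sum_nonneg fun _ _ => sq_nonneg _)
    refine div_le_div_of_nonneg_left hα.le hpos' (Real.sqrt_le_sqrt ?_)
    linarith
  rwa [div_mul_eq_mul_div, div_le_iff₀ hR] at hQ

end Pathwise

/-! ### Sub-Gaussian noise -/

theorem exp_le_add_exp_sq (x : ℝ) : Real.exp x ≤ x + Real.exp (x ^ 2) := by
  have hsq := Real.add_one_le_exp (x ^ 2)
  rcases le_or_gt |x| 1 with h | h
  · have := (abs_le.1 (Real.abs_exp_sub_one_sub_id_le h)).2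
    linarith
  · rcases lt_abs.1 h with h | h
    · have : Real.exp x ≤ Real.exp (x ^ 2) := Real.exp_le_exp.2 (by nlinarith)
      linarith
    · have : Real.exp x ≤ 1 := Real.exp_le_one_iff.2 (by linarith)
      nlinarith

/-- A pointwise substitute for Jensen's inequality `E exp (p Y) ≤ (E exp Y) ^ p`. -/
theorem exp_mul_le {p a : ℝ} (hp0 : 0 ≤ p) (hp1 : p ≤ 1) :
    Real.exp (p * a) ≤ 1 - p + p * Real.exp a := by
  have := convexOn_exp.2 (Set.mem_univ 0) (Set.mem_univ a) (sub_nonneg.2 hp1) hp0 (by ring)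
  simpa using this

/-- A centred vector with `E exp(‖X‖² / σ²) ≤ e` is sub-Gaussian in every direction. -/
theorem lintegral_exp_inner_le_one {E Ω : Type*} [NormedAddCommGroup E] [InnerProductSpace ℝ E]
    [CompleteSpace E] [MeasurableSpace Ω] {P : Measure Ω} [IsProbabilityMeasure P] {X : Ω → E}
    {σ : ℝ} (hσ : 0 < σ) (hX : Integrable X P) (hX0 : ∫ ω, X ω ∂P = 0)
    (hexp : ∫⁻ ω, ENNReal.ofReal (Real.exp (‖X ω‖ ^ 2 / σ ^ 2)) ∂P ≤
      ENNReal.ofReal (Real.exp 1)) (v : E) :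
    ∫⁻ ω, ENNReal.ofReal (Real.exp (inner ℝ v (X ω) - σ ^ 2 * ‖v‖ ^ 2)) ∂P ≤ 1 := by
  set s := σ * ‖v‖ with hs
  have hs0 : 0 ≤ s := by positivity
  have hs2 : σ ^ 2 * ‖v‖ ^ 2 = s ^ 2 := by rw [hs, mul_pow]
  set r : Ω → ℝ := fun ω => ‖X ω‖ ^ 2 / σ ^ 2 with hr
  have hrm : AEStronglyMeasurable (fun ω => Real.exp (r ω)) P :=
    (Real.continuous_exp.comp ((continuous_norm.pow 2).div_const
      (σ ^ 2))).comp_aestronglyMeasurable hX.1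
  have hri : Integrable (fun ω => Real.exp (r ω)) P := by
    refine ⟨hrm, ?_⟩
    rw [hasFiniteIntegral_iff_ofReal (ae_of_all _ fun ω => (Real.exp_pos _).le)]
    exact hexp.trans_lt ENNReal.ofReal_lt_top
  have hrint : ∫ ω, Real.exp (r ω - 1) ∂P ≤ 1 := by
    have h1 : ∫ ω, Real.exp (r ω) ∂P ≤ Real.exp 1 := by
      rw [← ofReal_integral_eq_lintegral_ofReal hri
        (ae_of_all _ fun ω => (Real.exp_pos _).le)] at hexp
      exact (ENNReal.ofReal_le_ofReal_iff (Real.exp_pos 1).le).1 hexp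
    simp_rw [Real.exp_sub]
    rw [integral_div, div_le_one (Real.exp_pos 1)]
    exact h1
  have hri' : Integrable (fun ω => Real.exp (r ω - 1)) P := by
    simp_rw [Real.exp_sub]
    exact hri.div_const _
  have hvi : Integrable (fun ω => inner ℝ v (X ω)) P := hX.const_inner v
  have hv0 : ∫ ω, inner ℝ v (X ω) ∂P = 0 := by
    rw [integral_inner hX, hX0, inner_zero_right]
  have hbr : ∀ ω, |inner ℝ v (X ω)| ≤ ‖v‖ * ‖X ω‖ := fun ω => abs_real_inner_le_norm _ _
  have hsr : ∀ ω, (‖v‖ * ‖X ω‖) ^ 2 = s ^ 2 * r ω := fun ω => by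
    simp only [hs, hr]
    field_simp
  -- a pointwise bound by `a ⟨v, X⟩ + 1 - p + p exp (r - 1)` with `p ≤ 1`
  obtain ⟨a, p, hp0, hp1, hle⟩ : ∃ a p : ℝ, 0 ≤ p ∧ p ≤ 1 ∧ ∀ ω,
      Real.exp (inner ℝ v (X ω) - σ ^ 2 * ‖v‖ ^ 2) ≤
        a * inner ℝ v (X ω) + (1 - p + p * Real.exp (r ω - 1)) := by
    rcases le_or_gt s 1 with h1 | h1
    · refine ⟨Real.exp (-s ^ 2), s ^ 2, by positivity, by nlinarith, fun ω => ?_⟩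
      have h2 := exp_le_add_exp_sq (inner ℝ v (X ω))
      have h3 : Real.exp (inner ℝ v (X ω) ^ 2) ≤ Real.exp (s ^ 2 * r ω) := by
        rw [Real.exp_le_exp, ← hsr]
        exact sq_le_sq.2 ((hbr ω).trans (le_abs_self _))
      have h4 := exp_mul_le (p := s ^ 2) (a := r ω - 1) (by positivity) (by nlinarith)
      have h5 : Real.exp (-s ^ 2) * Real.exp (s ^ 2 * r ω) = Real.exp (s ^ 2 * (r ω - 1)) := by
        rw [← Real.exp_add]; ring_nf
      rw [hs2, sub_eq_neg_add, Real.exp_add]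
      calc Real.exp (-s ^ 2) * Real.exp (inner ℝ v (X ω))
          ≤ Real.exp (-s ^ 2) * (inner ℝ v (X ω) + Real.exp (s ^ 2 * r ω)) := by
            gcongr; linarith
        _ ≤ _ := by rw [mul_add, h5]; linarith
    · refine ⟨0, 1 / 2, by norm_num, by norm_num, fun ω => ?_⟩
      have h4 := exp_mul_le (p := 1 / 2) (a := r ω - 1) (by norm_num) (by norm_num)
      refine le_trans (Real.exp_le_exp.2 ?_) (h4.trans_eq (by ring))
      have h5 : ‖X ω‖ / σ * (‖X ω‖ / σ) = r ω := by simp only [hr]; field_simp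
      have h6 : ‖v‖ * ‖X ω‖ = s * (‖X ω‖ / σ) := by simp only [hs]; field_simp
      have h7 := (le_abs_self _).trans (hbr ω)
      rw [hs2]
      nlinarith [sq_nonneg (s - ‖X ω‖ / σ)]
  have hbi : Integrable (fun ω => a * inner ℝ v (X ω) + (1 - p + p * Real.exp (r ω - 1))) P :=
    (hvi.const_mul a).add ((integrable_const _).add (hri'.const_mul p))
  calc ∫⁻ ω, ENNReal.ofReal (Real.exp (inner ℝ v (X ω) - σ ^ 2 * ‖v‖ ^ 2)) ∂P
      ≤ ∫⁻ ω, ENNReal.ofReal (a * inner ℝ v (X ω) + (1 - p + p * Real.exp (r ω - 1))) ∂P :=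
        lintegral_mono fun ω => ENNReal.ofReal_le_ofReal (hle ω)
    _ = ENNReal.ofReal (∫ ω, (a * inner ℝ v (X ω) + (1 - p + p * Real.exp (r ω - 1))) ∂P) :=
        (ofReal_integral_eq_lintegral_ofReal hbi
          (ae_of_all _ fun ω => (Real.exp_pos _).le.trans (hle ω))).symm
    _ ≤ 1 := by
        have h1 : ∫ ω, (a * inner ℝ v (X ω) + (1 - p + p * Real.exp (r ω - 1))) ∂P =
            a * ∫ ω, inner ℝ v (X ω) ∂P + (1 - p + p * ∫ ω, Real.exp (r ω - 1) ∂P) := by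
          rw [integral_add (f := fun ω => a * inner ℝ v (X ω))
            (g := fun ω => 1 - p + p * Real.exp (r ω - 1)) (hvi.const_mul a)
            ((integrable_const _).add (hri'.const_mul p)),
            integral_add (f := fun _ => 1 - p) (integrable_const _) (hri'.const_mul p),
            integral_const_mul, integral_const_mul]
          simp
        rw [ENNReal.ofReal_le_one, h1, hv0]
        nlinarith

/-! ### Past and present of the run -/

section Independence

variable {Ω Ξ A : Type*} [MeasurableSpace Ω] [MeasurableSpace Ξ] [MeasurableSpace A]
  {P : Measure Ω} [IsProbabilityMeasure P] {ξ : ℕ → Ω → Ξ}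

/-- A measurable function of the seeds before time `t` is independent of the seed at time `t`. -/
theorem indepFun_of_past (hξ : ∀ t, Measurable (ξ t)) (hind : iIndepFun ξ P) {t : ℕ}
    {Φ : (ℕ → Ξ) → A} (hΦ : Measurable Φ) (hpast : ∀ s s', (∀ i < t, s i = s' i) → Φ s = Φ s') :
    IndepFun (fun ω => Φ fun i => ξ i ω) (ξ t) P := by
  obtain ⟨ω₀⟩ : Nonempty Ω := P.nonempty_of_neZero
  have h := hind.indepFun_finset (Finset.range t) {t} (by simp) hξ
  have hext : Measurable fun (w : Finset.range t → Ξ) (i : ℕ) =>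
      if hi : i ∈ Finset.range t then w ⟨i, hi⟩ else ξ 0 ω₀ := by
    refine measurable_pi_lambda _ fun i => ?_
    by_cases hi : i ∈ Finset.range t
    · simpa only [hi, dite_true] using measurable_pi_apply _
    · simpa only [hi, dite_false] using measurable_const
  have h' := h.comp (hΦ.comp hext)
    (measurable_pi_apply (⟨t, Finset.mem_singleton_self t⟩ : ({t} : Finset ℕ)))
  refine (?_ : (fun ω => Φ fun i => ξ i ω) = _) ▸ h'
  funext ω
  refine hpast _ _ fun i hi => ?_
  simp [hi]

/-- Fubini for a function of two independent variables. -/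
theorem lintegral_indepFun {B : Type*} [MeasurableSpace B] {U : Ω → A} {V : Ω → B}
    (hU : Measurable U) (hV : Measurable V) (hUV : IndepFun U V P)
    {h : A × B → ENNReal} (hh : Measurable h) :
    ∫⁻ ω, h (U ω, V ω) ∂P = ∫⁻ ω, ∫⁻ ω', h (U ω, V ω') ∂P ∂P := by
  rw [← lintegral_map hh (hU.prodMk hV), hUV.map_prod_eq_prod_map_map hU.aemeasurable
    hV.aemeasurable, lintegral_prod _ hh.aemeasurable,
    lintegral_map hh.lintegral_prod_right' hU]
  refine lintegral_congr fun ω => ?_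
  exact lintegral_map (hh.comp measurable_prodMk_left) hV

end Independence

section Measurability

variable {d : ℕ} {Ξ : Type*} {f : EuclideanSpace ℝ (Fin d) → ℝ}
  {g : EuclideanSpace ℝ (Fin d) → Ξ → EuclideanSpace ℝ (Fin d)} {α β μ : ℝ}
  {x₁ : EuclideanSpace ℝ (Fin d)}

theorem run_congr {t : ℕ} {s s' : ℕ → Ξ} (h : ∀ i < t, s i = s' i) :
    run g α β μ x₁ s t = run g α β μ x₁ s' t := by
  induction t with
  | zero => rfl
  | succ t ih =>
    rw [run, run, ih fun i hi => h i (by omega), h t (by omega)]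

theorem iterate_congr {t : ℕ} {s s' : ℕ → Ξ} (h : ∀ i < t, s i = s' i) :
    iterate g α β μ x₁ s t = iterate g α β μ x₁ s' t := by
  rw [iterate, iterate, run_congr h]

theorem scaledGradient_congr {t : ℕ} {s s' : ℕ → Ξ} (h : ∀ i < t, s i = s' i) :
    scaledGradient f g α β μ x₁ s t = scaledGradient f g α β μ x₁ s' t := by
  rw [scaledGradient, scaledGradient, iterate, iterate, run_congr h]

theorem noise_congr {t : ℕ} {s s' : ℕ → Ξ} (h : ∀ i < t + 1, s i = s' i) :
    noise f g α β μ x₁ s t = noise f g α β μ x₁ s' t := by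
  rw [noise, noise, oracle, oracle, iterate_congr fun i hi => h i (by omega), h t (by omega)]

theorem IsSmooth.measurable_gradient {M : ℝ} (hf : IsSmooth M f) : Measurable (gradient f) := by
  refine (LipschitzWith.of_dist_le' (K := M) fun x y => ?_).continuous.measurable
  rw [dist_eq_norm, dist_eq_norm]
  exact hf.2 x y

variable [MeasurableSpace Ξ]

theorem measurable_run
    (hg : Measurable fun p : EuclideanSpace ℝ (Fin d) × Ξ => g p.1 p.2) (t : ℕ) :
    (Measurable fun s : ℕ → Ξ => (run g α β μ x₁ s t).x) ∧
      (Measurable fun s : ℕ → Ξ => (run g α β μ x₁ s t).m) ∧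
      Measurable fun s : ℕ → Ξ => (run g α β μ x₁ s t).sumSq := by
  induction t with
  | zero => exact ⟨measurable_const, measurable_const, measurable_const⟩
  | succ t ih =>
    obtain ⟨hx, hm, hS⟩ := ih
    have hG : Measurable fun s : ℕ → Ξ => g (run g α β μ x₁ s t).x (s t) :=
      hg.comp (hx.prodMk (measurable_pi_apply t))
    have hGj : ∀ j, Measurable fun s : ℕ → Ξ => g (run g α β μ x₁ s t).x (s t) j := fun j =>
      (EuclideanSpace.proj (𝕜 := ℝ) j).continuous.measurable.comp hG
    have hSj : ∀ j, Measurable fun s : ℕ → Ξ => (run g α β μ x₁ s t).sumSq j := fun j =>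
      (measurable_pi_apply j).comp hS
    have hm' : Measurable fun s : ℕ → Ξ => (run g α β μ x₁ s (t + 1)).m := by
      refine (hm.const_smul μ).add ((WithLp.measurable_toLp 2 _).comp
        (measurable_pi_lambda _ fun j => ?_))
      exact (measurable_const.div (measurable_const.add (hSj j)).sqrt).mul (hGj j)
    exact ⟨hx.sub hm', hm', measurable_pi_lambda _ fun j => (hSj j).add ((hGj j).pow_const 2)⟩

theorem measurable_iterate
    (hg : Measurable fun p : EuclideanSpace ℝ (Fin d) × Ξ => g p.1 p.2) (t : ℕ) :
    Measurable fun s : ℕ → Ξ => iterate g α β μ x₁ s t :=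
  (measurable_run hg t).1

theorem measurable_noise {M : ℝ} (hf : IsSmooth M f)
    (hg : Measurable fun p : EuclideanSpace ℝ (Fin d) × Ξ => g p.1 p.2) (t : ℕ) :
    Measurable fun s : ℕ → Ξ => noise f g α β μ x₁ s t :=
  (hf.measurable_gradient.comp (measurable_iterate hg t)).sub
    (hg.comp ((measurable_iterate hg t).prodMk (measurable_pi_apply t)))

theorem measurable_scaledGradient {M : ℝ} (hf : IsSmooth M f)
    (hg : Measurable fun p : EuclideanSpace ℝ (Fin d) × Ξ => g p.1 p.2) (t : ℕ) :
    Measurable fun s : ℕ → Ξ => scaledGradient f g α β μ x₁ s t := by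
  refine (WithLp.measurable_toLp 2 _).comp (measurable_pi_lambda _ fun j => ?_)
  refine (measurable_const.div (measurable_const.add
    ((measurable_pi_apply j).comp (measurable_run hg t).2.2)).sqrt).mul ?_
  exact (EuclideanSpace.proj (𝕜 := ℝ) j).continuous.measurable.comp
    (hf.measurable_gradient.comp (measurable_iterate hg t))

end Measurability

/-! ### High-probability events -/

section Tail

variable {d : ℕ} {Ω Ξ : Type*} [MeasurableSpace Ω] [MeasurableSpace Ξ]
  {P : Measure Ω} [IsProbabilityMeasure P] {ξ : ℕ → Ω → Ξ} {f : EuclideanSpace ℝ (Fin d) → ℝ}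
  {g : EuclideanSpace ℝ (Fin d) → Ξ → EuclideanSpace ℝ (Fin d)} {M σ : ℝ} (α β μ : ℝ)
  (x₁ : EuclideanSpace ℝ (Fin d))

/-- The query point `x_t` may be frozen when averaging over the seed of step `t`. -/
theorem lintegral_noise (hξ : ∀ t, Measurable (ξ t)) (hind : iIndepFun ξ P)
    (hf : IsSmooth M f) (hg : Measurable fun p : EuclideanSpace ℝ (Fin d) × Ξ => g p.1 p.2)
    {H : EuclideanSpace ℝ (Fin d) → ENNReal} (hH : Measurable H) (t : ℕ) :
    ∫⁻ ω, H (noise f g α β μ x₁ (fun i => ξ i ω) t) ∂P =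
      ∫⁻ ω, ∫⁻ ω', H (gradient f (iterate g α β μ x₁ (fun i => ξ i ω) t) -
        g (iterate g α β μ x₁ (fun i => ξ i ω) t) (ξ t ω')) ∂P ∂P := by
  have hseed : Measurable fun ω i => ξ i ω := measurable_pi_lambda _ hξ
  exact lintegral_indepFun ((measurable_iterate hg t).comp hseed) (hξ t)
    (indepFun_of_past hξ hind (measurable_iterate hg t) fun s s' h => iterate_congr h)
    (h := fun p => H (gradient f p.1 - g p.1 p.2))
    (hH.comp ((hf.measurable_gradient.comp measurable_fst).sub hg))

theorem noise_eq_zero_ae (hξ : ∀ t, Measurable (ξ t)) (hind : iIndepFun ξ P)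
    (hf : IsSmooth M f) (hg : Measurable fun p : EuclideanSpace ℝ (Fin d) × Ξ => g p.1 p.2)
    (hnoise : ∀ t, HasSubGaussianNoise f g P (ξ t) 0) (t : ℕ) :
    ∀ᵐ ω ∂P, noise f g α β μ x₁ (fun i => ξ i ω) t = 0 := by
  have h := lintegral_noise α β μ x₁ hξ hind hf hg measurable_enorm t
  have h0 : ∀ x, ∫⁻ ω', ‖gradient f x - g x (ξ t ω')‖ₑ ∂P = 0 := fun x => by
    refine lintegral_eq_zero_of_ae_eq_zero ?_
    filter_upwards [(hnoise t x).1 rfl] with ω hω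
    simp [hω]
  simp only [h0, lintegral_zero] at h
  have hm : Measurable fun ω => ‖noise f g α β μ x₁ (fun i => ξ i ω) t‖ₑ :=
    ((measurable_noise hf hg t).comp (measurable_pi_lambda _ hξ)).enorm
  filter_upwards [(lintegral_eq_zero_iff hm).1 h] with ω hω
  simpa using hω

/-- Markov's inequality for `exp (‖noise_t‖² / σ²)`. -/
theorem measure_noise_gt_le (hξ : ∀ t, Measurable (ξ t)) (hind : iIndepFun ξ P)
    (hf : IsSmooth M f) (hg : Measurable fun p : EuclideanSpace ℝ (Fin d) × Ξ => g p.1 p.2)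
    (hσ : 0 < σ) (hnoise : ∀ t, HasSubGaussianNoise f g P (ξ t) σ) (L : ℝ) (t : ℕ) :
    P {ω | σ ^ 2 * L < ‖noise f g α β μ x₁ (fun i => ξ i ω) t‖ ^ 2} ≤
      ENNReal.ofReal (Real.exp (1 - L)) := by
  have hH : Measurable fun w : EuclideanSpace ℝ (Fin d) =>
      ENNReal.ofReal (Real.exp (‖w‖ ^ 2 / σ ^ 2)) := by fun_prop
  have hint : ∫⁻ ω, ENNReal.ofReal (Real.exp
      (‖noise f g α β μ x₁ (fun i => ξ i ω) t‖ ^ 2 / σ ^ 2)) ∂P ≤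
      ENNReal.ofReal (Real.exp 1) := by
    rw [lintegral_noise α β μ x₁ hξ hind hf hg hH t]
    refine (lintegral_mono fun ω => (hnoise t _).2 hσ.ne').trans ?_
    simp
  have hm := hH.comp ((measurable_noise (α := α) (β := β) (μ := μ) (x₁ := x₁) hf hg t).comp
    (measurable_pi_lambda _ hξ))
  have h := meas_ge_le_lintegral_div hm.aemeasurable (μ := P)
    (ε := ENNReal.ofReal (Real.exp L)) (by simp [Real.exp_pos]) ENNReal.ofReal_ne_top
  refine (measure_mono fun ω hω => ?_).trans (h.trans ?_)
  · refine ENNReal.ofReal_le_ofReal (Real.exp_le_exp.2 ?_)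
    rw [le_div_iff₀ (by positivity), mul_comm]
    exact (Set.mem_ofPred.1 hω).le
  · rw [Real.exp_sub, ENNReal.ofReal_div_of_pos (Real.exp_pos L)]
    gcongr
    exact hint

/-- The exponential supermartingale of the sums `∑ ⟨l η_t ∇f(x_t), noise_t⟩`. -/
theorem lintegral_exp_sum_le_one (hξ : ∀ t, Measurable (ξ t)) (hind : iIndepFun ξ P)
    (hf : IsSmooth M f) (hg : Measurable fun p : EuclideanSpace ℝ (Fin d) × Ξ => g p.1 p.2)
    (hunb : ∀ t, IsUnbiased f g P (ξ t)) (hσ : 0 < σ)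
    (hnoise : ∀ t, HasSubGaussianNoise f g P (ξ t) σ) (l : ℝ) (T : ℕ) :
    ∫⁻ ω, ENNReal.ofReal (Real.exp (∑ t ∈ Finset.range T,
      (inner ℝ (l • scaledGradient f g α β μ x₁ (fun i => ξ i ω) t)
        (noise f g α β μ x₁ (fun i => ξ i ω) t) -
        σ ^ 2 * ‖l • scaledGradient f g α β μ x₁ (fun i => ξ i ω) t‖ ^ 2))) ∂P ≤ 1 := by
  induction T with
  | zero => simp
  | succ T ih =>
    set W : (ℕ → Ξ) → ℝ := fun s => ∑ t ∈ Finset.range T,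
      (inner ℝ (l • scaledGradient f g α β μ x₁ s t) (noise f g α β μ x₁ s t) -
        σ ^ 2 * ‖l • scaledGradient f g α β μ x₁ s t‖ ^ 2)
    have hv : ∀ t, Measurable fun s : ℕ → Ξ => l • scaledGradient f g α β μ x₁ s t :=
      fun t => (measurable_scaledGradient hf hg t).const_smul l
    have hWm : Measurable W := Finset.measurable_fun_sum _ fun t _ =>
      ((hv t).inner (measurable_noise hf hg t)).sub ((hv t).norm.pow_const 2 |>.const_mul _)
    have hΦ : Measurable fun s : ℕ → Ξ =>
        (W s, iterate g α β μ x₁ s T, l • scaledGradient f g α β μ x₁ s T) :=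
      hWm.prodMk ((measurable_iterate hg T).prodMk (hv T))
    have hpast : ∀ s s' : ℕ → Ξ, (∀ i < T, s i = s' i) →
        (W s, iterate g α β μ x₁ s T, l • scaledGradient f g α β μ x₁ s T) =
        (W s', iterate g α β μ x₁ s' T, l • scaledGradient f g α β μ x₁ s' T) := by
      intro s s' h
      rw [iterate_congr h, scaledGradient_congr h]
      congr 1
      refine Finset.sum_congr rfl fun t ht => ?_
      have ht' := Finset.mem_range.1 ht
      rw [scaledGradient_congr fun i hi => h i (by omega), noise_congr fun i hi => h i (by omega)]
    have hh : Measurable fun p :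
        (ℝ × EuclideanSpace ℝ (Fin d) × EuclideanSpace ℝ (Fin d)) × Ξ =>
        ENNReal.ofReal (Real.exp p.1.1) * ENNReal.ofReal (Real.exp
          (inner ℝ p.1.2.2 (gradient f p.1.2.1 - g p.1.2.1 p.2) - σ ^ 2 * ‖p.1.2.2‖ ^ 2)) := by
      have h1 : Measurable fun p :
          (ℝ × EuclideanSpace ℝ (Fin d) × EuclideanSpace ℝ (Fin d)) × Ξ =>
          gradient f p.1.2.1 - g p.1.2.1 p.2 :=
        (hf.measurable_gradient.comp (by fun_prop)).sub
          (hg.comp (f := fun p : (ℝ × EuclideanSpace ℝ (Fin d) × EuclideanSpace ℝ (Fin d)) × Ξ =>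
            (p.1.2.1, p.2)) (by fun_prop))
      have h2 : Measurable fun p :
          (ℝ × EuclideanSpace ℝ (Fin d) × EuclideanSpace ℝ (Fin d)) × Ξ => p.1.2.2 := by fun_prop
      have h3 := h2.inner (𝕜 := ℝ) h1
      fun_prop
    have hstep := lintegral_indepFun (hΦ.comp (measurable_pi_lambda _ hξ)) (hξ T)
      (indepFun_of_past hξ hind hΦ hpast) hh
    refine le_trans (le_of_eq ?_) (hstep.le.trans (le_trans (lintegral_mono fun ω => ?_) ih))
    · refine lintegral_congr fun ω => ?_
      rw [Finset.sum_range_succ, Real.exp_add, ENNReal.ofReal_mul (Real.exp_pos _).le]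
      rfl
    · dsimp only [Function.comp]
      rw [lintegral_const_mul' _ _ ENNReal.ofReal_ne_top]
      refine mul_le_of_le_one_right' ?_
      set x := iterate g α β μ x₁ (fun i => ξ i ω) T
      obtain ⟨hi, he⟩ := hunb T x
      refine lintegral_exp_inner_le_one hσ ((integrable_const _).sub hi) ?_
        ((hnoise T x).2 hσ.ne') _
      refine (integral_sub (f := fun _ => gradient f x) (integrable_const _) hi).trans ?_
      rw [he]
      simp

/-- The martingale `∑ ⟨η_t ∇f(x_t), noise_t⟩` exceeds a quarter of the progress by more than a
multiple of `B` only with probability `exp (-B)`. -/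
theorem measure_sum_gt_le (hξ : ∀ t, Measurable (ξ t)) (hind : iIndepFun ξ P)
    (hf : IsSmooth M f) (hg : Measurable fun p : EuclideanSpace ℝ (Fin d) × Ξ => g p.1 p.2)
    (hunb : ∀ t, IsUnbiased f g P (ξ t)) (hσ : 0 < σ)
    (hnoise : ∀ t, HasSubGaussianNoise f g P (ξ t) σ) {α β : ℝ} (hα : 0 < α) (hβ : 0 < β)
    (B : ℝ) (T : ℕ) :
    P {ω | progress f g α β μ x₁ (fun i => ξ i ω) T / 4 + 4 * α * σ ^ 2 / √β * B <
        ∑ t ∈ Finset.range T, inner ℝ (scaledGradient f g α β μ x₁ (fun i => ξ i ω) t)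
          (noise f g α β μ x₁ (fun i => ξ i ω) t)} ≤
      ENNReal.ofReal (Real.exp (-B)) := by
  have hsβ : 0 < √β := Real.sqrt_pos.2 hβ
  -- `l` is such that `σ² l² ‖η ∇f‖² ≤ σ² l² (α / √β) ⟨η ∇f, ∇f⟩ = (l / 4) ⟨η ∇f, ∇f⟩`
  set l := √β / (4 * α * σ ^ 2) with hl
  have hl0 : 0 < l := by positivity
  have hint := lintegral_exp_sum_le_one α β μ x₁ hξ hind hf hg hunb hσ hnoise l T
  have hm : Measurable fun ω => ENNReal.ofReal (Real.exp (∑ t ∈ Finset.range T,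
      (inner ℝ (l • scaledGradient f g α β μ x₁ (fun i => ξ i ω) t)
        (noise f g α β μ x₁ (fun i => ξ i ω) t) -
        σ ^ 2 * ‖l • scaledGradient f g α β μ x₁ (fun i => ξ i ω) t‖ ^ 2))) := by
    have hseed : Measurable fun ω i => ξ i ω := measurable_pi_lambda _ hξ
    have hv : ∀ t, Measurable fun ω => l • scaledGradient f g α β μ x₁ (fun i => ξ i ω) t :=
      fun t => ((measurable_scaledGradient hf hg t).comp hseed).const_smul l
    exact (Finset.measurable_fun_sum _ fun t _ =>
      ((hv t).inner ((measurable_noise hf hg t).comp hseed)).sub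
        ((hv t).norm.pow_const 2 |>.const_mul _)).exp.ennreal_ofReal
  have h := meas_ge_le_lintegral_div hm.aemeasurable (μ := P)
    (ε := ENNReal.ofReal (Real.exp B)) (by simp [Real.exp_pos]) ENNReal.ofReal_ne_top
  refine (measure_mono fun ω hω => ?_).trans (h.trans ?_)
  · refine ENNReal.ofReal_le_ofReal (Real.exp_le_exp.2 ?_)
    have hω' := Set.mem_ofPred.1 hω
    set Z := ∑ t ∈ Finset.range T, inner ℝ (scaledGradient f g α β μ x₁ (fun i => ξ i ω) t)
          (noise f g α β μ x₁ (fun i => ξ i ω) t) with hZ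
    have h1 : l * Z - l / 4 * progress f g α β μ x₁ (fun i => ξ i ω) T ≤
        ∑ t ∈ Finset.range T,
      (inner ℝ (l • scaledGradient f g α β μ x₁ (fun i => ξ i ω) t)
        (noise f g α β μ x₁ (fun i => ξ i ω) t) -
        σ ^ 2 * ‖l • scaledGradient f g α β μ x₁ (fun i => ξ i ω) t‖ ^ 2) := by
      rw [progress, hZ, Finset.mul_sum, Finset.mul_sum, ← Finset.sum_sub_distrib]
      refine Finset.sum_le_sum fun t _ => ?_
      rw [real_inner_smul_left, norm_smul, Real.norm_of_nonneg hl0.le, mul_pow]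
      have h2 := norm_scaledGradient_sq_le (f := f) (g := g) (μ := μ) (x₁ := x₁)
        (s := fun i => ξ i ω) hα hβ t
      have h3 : σ ^ 2 * (l ^ 2 * (α / √β)) = l / 4 := by
        rw [hl]; field_simp
      have h4 := mul_le_mul_of_nonneg_left h2 (show 0 ≤ σ ^ 2 * l ^ 2 by positivity)
      rw [← mul_assoc (σ ^ 2 * l ^ 2), mul_assoc (σ ^ 2) _ (α / √β), h3, mul_assoc] at h4
      linarith
    have h2 : l * (progress f g α β μ x₁ (fun i => ξ i ω) T / 4 + 4 * α * σ ^ 2 / √β * B) =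
        l / 4 * progress f g α β μ x₁ (fun i => ξ i ω) T + B := by
      rw [hl]; field_simp
    have h3 := mul_le_mul_of_nonneg_left hω'.le hl0.le
    linarith
  · rw [Real.exp_neg, ENNReal.ofReal_inv_of_pos (Real.exp_pos _), ← one_div]
    gcongr

/-- With probability at least `1 - δ`, all the noise is bounded and the martingale is controlled by
the progress. -/
theorem ofReal_one_sub_le_measure (hξ : ∀ t, Measurable (ξ t)) (hind : iIndepFun ξ P)
    (hf : IsSmooth M f) (hg : Measurable fun p : EuclideanSpace ℝ (Fin d) × Ξ => g p.1 p.2)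
    (hunb : ∀ t, IsUnbiased f g P (ξ t)) (hσ : 0 ≤ σ)
    (hnoise : ∀ t, HasSubGaussianNoise f g P (ξ t) σ) {α β : ℝ} (hα : 0 < α) (hβ : 0 < β)
    {T : ℕ} (hT : 1 ≤ T) {δ : ℝ} (hδ : 0 < δ) :
    ENNReal.ofReal (1 - δ) ≤ P {ω |
      (∀ t < T, ‖noise f g α β μ x₁ (fun i => ξ i ω) t‖ ^ 2 ≤
        σ ^ 2 * Real.log (3 * T * Real.exp 1 / δ)) ∧
      ∑ t ∈ Finset.range T, inner ℝ (scaledGradient f g α β μ x₁ (fun i => ξ i ω) t)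
          (noise f g α β μ x₁ (fun i => ξ i ω) t) ≤
        progress f g α β μ x₁ (fun i => ξ i ω) T / 4 +
          4 * α * σ ^ 2 / √β * Real.log (3 / δ)} := by
  set L := Real.log (3 * T * Real.exp 1 / δ) with hL
  set good := {ω |
      (∀ t < T, ‖noise f g α β μ x₁ (fun i => ξ i ω) t‖ ^ 2 ≤ σ ^ 2 * L) ∧
      ∑ t ∈ Finset.range T, inner ℝ (scaledGradient f g α β μ x₁ (fun i => ξ i ω) t)
          (noise f g α β μ x₁ (fun i => ξ i ω) t) ≤
        progress f g α β μ x₁ (fun i => ξ i ω) T / 4 +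
          4 * α * σ ^ 2 / √β * Real.log (3 / δ)} with hgood
  have h1 : P goodᶜ ≤ ENNReal.ofReal δ := by
    rcases hσ.eq_or_lt with rfl | hσ
    · have hae : ∀ᵐ ω ∂P, ω ∈ good := by
        filter_upwards [ae_all_iff.2 fun t => noise_eq_zero_ae α β μ x₁ hξ hind hf hg hnoise t]
          with ω hω
        have hpr : 0 ≤ progress f g α β μ x₁ (fun i => ξ i ω) T / 4 := by
          rw [progress_eq]
          exact div_nonneg (Finset.sum_nonneg fun j _ => Finset.sum_nonneg fun t _ =>
            mul_nonneg (eta_pos hα hβ _ _).le (sq_nonneg _)) (by norm_num)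
        simp only [hgood, Set.mem_ofPred_eq, hω]
        simpa using hpr
      exact (mem_ae_iff.1 hae).trans_le zero_le
    have hT0 : (0 : ℝ) < T := by exact_mod_cast hT
    have hsub : goodᶜ ⊆ (⋃ t ∈ Finset.range T,
        {ω | σ ^ 2 * L < ‖noise f g α β μ x₁ (fun i => ξ i ω) t‖ ^ 2}) ∪
        {ω | progress f g α β μ x₁ (fun i => ξ i ω) T / 4 +
          4 * α * σ ^ 2 / √β * Real.log (3 / δ) <
        ∑ t ∈ Finset.range T, inner ℝ (scaledGradient f g α β μ x₁ (fun i => ξ i ω) t)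
        (noise f g α β μ x₁ (fun i => ξ i ω) t)} := by
      intro ω hω
      by_contra hc
      refine hω ⟨fun t ht => ?_, ?_⟩
      · by_contra hlt
        exact hc (Or.inl (Set.mem_biUnion (Finset.mem_coe.2 (Finset.mem_range.2 ht))
          (not_le.1 hlt)))
      · by_contra hlt
        exact hc (Or.inr (not_le.1 hlt))
    have he1 : Real.exp (1 - L) = δ / (3 * T) := by
      rw [Real.exp_sub, hL, Real.exp_log (by positivity)]
      have := Real.exp_pos 1
      field_simp
    have he2 : Real.exp (-Real.log (3 / δ)) = δ / 3 := by
      rw [Real.exp_neg, Real.exp_log (by positivity), inv_div]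
    calc P goodᶜ ≤ _ := measure_mono hsub
      _ ≤ _ := measure_union_le _ _
      _ ≤ ∑ t ∈ Finset.range T, ENNReal.ofReal (Real.exp (1 - L)) +
          ENNReal.ofReal (Real.exp (-Real.log (3 / δ))) := by
        refine add_le_add ((measure_biUnion_finset_le _ _).trans
          (Finset.sum_le_sum fun t _ => ?_)) ?_
        · exact measure_noise_gt_le α β μ x₁ hξ hind hf hg hσ hnoise L t
        · exact measure_sum_gt_le μ x₁ hξ hind hf hg hunb hσ hnoise hα hβ _ T
      _ = ENNReal.ofReal (δ / 3 + δ / 3) := by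
        rw [Finset.sum_const, Finset.card_range, he1, he2, ← ENNReal.ofReal_nsmul,
          ENNReal.ofReal_add (by positivity) (by positivity), nsmul_eq_mul]
        congr 2
        field_simp
      _ ≤ ENNReal.ofReal δ := ENNReal.ofReal_le_ofReal (by linarith)
  rw [ENNReal.ofReal_sub _ hδ.le, ENNReal.ofReal_one, tsub_le_iff_right]
  calc (1 : ENNReal) = P Set.univ := measure_univ.symm
    _ ≤ P good + P goodᶜ := measure_univ_le_add_compl good
    _ ≤ _ := by gcongr

end Tail

/-! ### The constant -/

/-- A value of the constant `c`. The second summand serves `T = 1`, the third the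
initial gap, and the others the terms proportional to `d α` and to `d α σ² ln (T / δ)`. -/
noncomputable def rateConst (M β Δ σ₀ : ℝ) : ℝ :=
  1 + (1 + M * |Δ|) * β / M ^ 2 + |Δ| * √β / M + √β / β + 60 / √β + √β * (1 / σ₀ ^ 2 + 1)

theorem rateConst_pos {M β Δ σ₀ : ℝ} (hM : 0 < M) (hβ : 0 < β) : 0 < rateConst M β Δ σ₀ := by
  unfold rateConst
  positivity

theorem stepParam_le {M α β μ : ℝ} (hM : 0 < M) (hμ0 : 0 ≤ μ) (hμ1 : μ < 1)
    (hαμ : 4 * α ≤ √β * (1 - μ) ^ 2 / (2 * M * (1 + μ))) : α ≤ √β / (8 * M) := by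
  have h1 : √β * (1 - μ) ^ 2 / (2 * M * (1 + μ)) ≤ √β * 1 / (2 * M * 1) := by
    have : (1 - μ) ^ 2 ≤ 1 := by nlinarith
    have : 1 ≤ 1 + μ := by linarith
    gcongr
  have h2 : √β * 1 / (2 * M * 1) = 4 * (√β / (8 * M)) := by field_simp; ring
  linarith

theorem add_le_constC {c α μ σ δ : ℝ} (hc : 0 ≤ c) (hα : 0 ≤ α) (hμ0 : 0 ≤ μ) (hμ1 : μ < 1)
    (hδ0 : 0 < δ) (hδ1 : δ < 1) (d : ℕ) {T : ℕ} (hT : 1 ≤ T) :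
    c * (1 / α + d * (α + σ ^ 2 * (α * Real.log (T / δ)))) ≤ constC c α μ σ δ d T := by
  have hp : 0 < 1 - μ := by linarith
  have hT' : (1 : ℝ) ≤ T := by exact_mod_cast hT
  have hl : 0 ≤ Real.log (T / δ) := Real.log_nonneg (by rw [le_div_iff₀ hδ0]; linarith)
  have hl' : 0 ≤ Real.log (1 / δ) := Real.log_nonneg (by rw [le_div_iff₀ hδ0]; linarith)
  unfold constC
  gcongr
  calc (d : ℝ) * (α + σ ^ 2 * (α * Real.log (T / δ)))
      ≤ d * (α + σ ^ 2 * (α * Real.log (T / δ) + Real.log (1 / δ) / (1 - μ))) := by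
        gcongr
        have : 0 ≤ Real.log (1 / δ) / (1 - μ) := by positivity
        linarith
    _ ≤ _ := by
        refine le_div_self (by positivity) hp (by linarith)

/-- The lower bound `σ₀ ≤ σ` is what allows a plain `ln T` to be absorbed into `σ² L`. -/
theorem log_one_add_mul_le {β σ σ₀ L : ℝ} (hβ : 0 < β) (hσ₀ : 0 < σ₀)
    (hσ : σ = 0 ∨ σ₀ ≤ σ) {T : ℕ} (hTL : Real.log (1 + T) ≤ L) :
    Real.log (1 + 4 * T * (σ ^ 2 * L) / β) ≤ 4 / β + (1 / σ₀ ^ 2 + 1) * (σ ^ 2 * L) := by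
  have hL0 : 0 ≤ L := le_trans (Real.log_nonneg (by simp)) hTL
  rcases hσ with rfl | hσ
  · simp only [ne_eq, OfNat.ofNat_ne_zero, not_false_eq_true, zero_pow, zero_mul, mul_zero,
      zero_div, add_zero, Real.log_one]
    positivity
  · have h1 : 1 + 4 * T * (σ ^ 2 * L) / β ≤ (1 + T) * (1 + 4 / β) * (1 + σ ^ 2 * L) := by
      have e : (1 + T) * (1 + 4 / β) * (1 + σ ^ 2 * L) = 1 + 4 * T * (σ ^ 2 * L) / β +
          (T + 4 / β + σ ^ 2 * L + T * (4 / β) + T * (σ ^ 2 * L) + 4 / β * (σ ^ 2 * L)) := by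
        field_simp; ring
      have : 0 ≤ T + 4 / β + σ ^ 2 * L + T * (4 / β) + T * (σ ^ 2 * L) +
          4 / β * (σ ^ 2 * L) := by positivity
      linarith
    have h2 := Real.log_le_log (by positivity) h1
    rw [Real.log_mul (by positivity) (by positivity),
      Real.log_mul (by positivity) (by positivity)] at h2
    have h3 := Real.log_le_sub_one_of_pos (show 0 < 1 + 4 / β by positivity)
    have h4 := Real.log_le_sub_one_of_pos (show 0 < 1 + σ ^ 2 * L by positivity)
    have h5 : L ≤ 1 / σ₀ ^ 2 * (σ ^ 2 * L) := by
      rw [← mul_assoc, div_mul_eq_mul_div, one_mul]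
      refine le_mul_of_one_le_left hL0 ?_
      rw [le_div_iff₀ (by positivity), one_mul]
      gcongr
    linarith

/-- The pathwise bound on the progress is at most `C(T)`. Since `T ≥ 2`, the quantity `ln (T / δ)`
is bounded away from zero and dominates the other logarithms. -/
theorem bound_le_constC {M β Δ σ₀ α μ σ δ : ℝ} (hM : 0 < M) (hβ : 0 < β) (hσ₀ : 0 < σ₀)
    (hα : 0 < α) (hμ0 : 0 ≤ μ) (hμ1 : μ < 1) (hαM : α ≤ √β / (8 * M))
    (hσ : σ = 0 ∨ σ₀ ≤ σ) (hδ0 : 0 < δ) (hδ1 : δ < 1) {d T : ℕ} (hd : 1 ≤ d) (hT : 2 ≤ T) :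
    8 / 3 * (Δ + 4 * α * σ ^ 2 / √β * Real.log (3 / δ) +
      d * (α * √β / 16 * Real.log (1 + 4 * T *
        (σ ^ 2 * Real.log (3 * T * Real.exp 1 / δ)) / β) +
        α / (8 * √β) * (σ ^ 2 * Real.log (3 * T * Real.exp 1 / δ)))) ≤
      constC (rateConst M β Δ σ₀) α μ σ δ d T := by
  refine le_trans ?_ (add_le_constC (rateConst_pos hM hβ).le hα.le hμ0 hμ1 hδ0 hδ1 d
    (by omega))
  have hT' : (2 : ℝ) ≤ T := by exact_mod_cast hT
  have hd' : (1 : ℝ) ≤ d := by exact_mod_cast hd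
  have hsβ : 0 < √β := Real.sqrt_pos.2 hβ
  have he2 : 2 ≤ Real.exp 1 := by linarith [Real.add_one_le_exp 1]
  have he3 : Real.exp 1 ≤ 3 := Real.exp_one_lt_three.le
  have hTδ : 2 ≤ T / δ := by rw [le_div_iff₀ hδ0]; nlinarith
  have hl : 0 ≤ Real.log (T / δ) := Real.log_nonneg (by linarith)
  have hL : Real.log (3 * T * Real.exp 1 / δ) ≤ 5 * Real.log (T / δ) := by
    have h1 : 3 * T * Real.exp 1 / δ ≤ (T / δ) ^ 5 := by
      have h2 : (2 : ℝ) ^ 4 ≤ (T / δ) ^ 4 := by gcongr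
      calc 3 * T * Real.exp 1 / δ = (3 * Real.exp 1) * (T / δ) := by ring
        _ ≤ (T / δ) ^ 4 * (T / δ) := by gcongr; linarith
        _ = _ := by ring
    have h2 := Real.log_le_log (by positivity) h1
    rwa [Real.log_pow] at h2
  have hL3 : Real.log (3 / δ) ≤ Real.log (3 * T * Real.exp 1 / δ) := by
    refine Real.log_le_log (by positivity) ?_
    gcongr
    nlinarith
  have hTL : Real.log (1 + T) ≤ Real.log (3 * T * Real.exp 1 / δ) := by
    refine Real.log_le_log (by positivity) ?_
    rw [le_div_iff₀ hδ0]
    have : (1 + T) * δ ≤ (1 + T) * 1 := by gcongr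
    nlinarith
  have hlog := log_one_add_mul_le hβ hσ₀ hσ hTL
  set L := Real.log (3 * T * Real.exp 1 / δ)
  set ℓ := Real.log (T / δ)
  set q := σ ^ 2 * ℓ with hq
  have hq0 : 0 ≤ q := by positivity
  have hσL : σ ^ 2 * L ≤ 5 * q := by
    rw [hq, mul_left_comm]
    gcongr
  have hσL3 : σ ^ 2 * Real.log (3 / δ) ≤ 5 * q :=
    (mul_le_mul_of_nonneg_left hL3 (sq_nonneg σ)).trans hσL
  have hΔ : Δ ≤ |Δ| * √β / (8 * M) * (1 / α) := by
    refine (le_abs_self Δ).trans ?_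
    rw [mul_one_div, le_div_iff₀ hα, mul_div_assoc]
    gcongr
  have hmart : 4 * α * σ ^ 2 / √β * Real.log (3 / δ) ≤ d * (20 / √β * (α * q)) := by
    calc 4 * α * σ ^ 2 / √β * Real.log (3 / δ)
        = 4 * α / √β * (σ ^ 2 * Real.log (3 / δ)) := by ring
      _ ≤ 4 * α / √β * (5 * q) := by gcongr
      _ = 1 * (20 / √β * (α * q)) := by ring
      _ ≤ _ := by gcongr
  have hlog' : α * √β / 16 * Real.log (1 + 4 * T * (σ ^ 2 * L) / β) ≤
      √β / (4 * β) * α + 5 / 16 * (√β * (1 / σ₀ ^ 2 + 1)) * (α * q) := by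
    calc α * √β / 16 * Real.log (1 + 4 * T * (σ ^ 2 * L) / β)
        ≤ α * √β / 16 * (4 / β + (1 / σ₀ ^ 2 + 1) * (5 * q)) := by
          gcongr
          exact hlog.trans (by gcongr)
      _ = _ := by field_simp; ring
  have hmax : α / (8 * √β) * (σ ^ 2 * L) ≤ 5 / (8 * √β) * (α * q) := by
    calc α / (8 * √β) * (σ ^ 2 * L) ≤ α / (8 * √β) * (5 * q) := by gcongr
      _ = _ := by ring
  have hsum : 8 / 3 * (Δ + 4 * α * σ ^ 2 / √β * Real.log (3 / δ) +
      d * (α * √β / 16 * Real.log (1 + 4 * T * (σ ^ 2 * L) / β) +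
        α / (8 * √β) * (σ ^ 2 * L))) ≤
      |Δ| * √β / M * (1 / α) + d * (√β / β * α) +
        d * ((60 / √β + √β * (1 / σ₀ ^ 2 + 1)) * (α * q)) := by
    have h1 := mul_le_mul_of_nonneg_left (add_le_add hlog' hmax) (Nat.cast_nonneg (α := ℝ) d)
    have e1 : |Δ| * √β / M * (1 / α) = 8 * (|Δ| * √β / (8 * M) * (1 / α)) := by field_simp
    have e2 : (d : ℝ) * (√β / β * α) = 4 * (d * (√β / (4 * β) * α)) := by field_simp
    have e3 : (d : ℝ) * (60 / √β * (α * q)) = 3 * (d * (20 / √β * (α * q))) := by ring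
    have e4 : (d : ℝ) * (5 / (8 * √β) * (α * q)) = 1 / 32 * (d * (20 / √β * (α * q))) := by
      field_simp; ring
    have p1 : 0 ≤ |Δ| * √β / (8 * M) * (1 / α) := by positivity
    have p2 : 0 ≤ d * (√β / (4 * β) * α) := by positivity
    have p3 : 0 ≤ d * (20 / √β * (α * q)) := by positivity
    have p4 : 0 ≤ d * (√β * (1 / σ₀ ^ 2 + 1) * (α * q)) := by positivity
    rw [add_mul, mul_add (d : ℝ) (60 / √β * (α * q)), e1, e2, e3]
    linarith
  refine hsum.trans ?_
  have hqα : σ ^ 2 * (α * ℓ) = α * q := by rw [hq]; ring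
  have p0 : 0 ≤ (1 + M * |Δ|) * β / M ^ 2 := by positivity
  have p1 : 0 ≤ |Δ| * √β / M := by positivity
  have p2 : 0 ≤ √β / β := by positivity
  have p3 : 0 ≤ 60 / √β := by positivity
  have p4 : 0 ≤ √β * (1 / σ₀ ^ 2 + 1) := by positivity
  have c1 : |Δ| * √β / M ≤ rateConst M β Δ σ₀ := by unfold rateConst; linarith
  have c2 : √β / β ≤ rateConst M β Δ σ₀ := by unfold rateConst; linarith
  have c3 : 60 / √β + √β * (1 / σ₀ ^ 2 + 1) ≤ rateConst M β Δ σ₀ := by unfold rateConst; linarith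
  rw [hqα]
  calc |Δ| * √β / M * (1 / α) + d * (√β / β * α) +
        d * ((60 / √β + √β * (1 / σ₀ ^ 2 + 1)) * (α * q))
      ≤ rateConst M β Δ σ₀ * (1 / α) + d * (rateConst M β Δ σ₀ * α) +
        d * (rateConst M β Δ σ₀ * (α * q)) := by gcongr
    _ = _ := by ring

/-- The case `T = 1` is deterministic: `‖∇f(x₁)‖² ≤ 2 M Δ`, and `C / α` is bounded below
because `α` is bounded above. -/
theorem two_mul_le_constC_sq {M β Δ σ₀ α μ σ δ : ℝ} (hM : 0 < M) (hβ : 0 < β)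
    (hα : 0 < α) (hμ0 : 0 ≤ μ) (hμ1 : μ < 1) (hαM : α ≤ √β / (8 * M))
    (hδ0 : 0 < δ) (hδ1 : δ < 1) (d : ℕ) {T : ℕ} (hT : 1 ≤ T) :
    2 * M * Δ ≤ 4 * constC (rateConst M β Δ σ₀) α μ σ δ d T ^ 2 / α ^ 2 := by
  have hsβ : 0 < √β := Real.sqrt_pos.2 hβ
  have hT' : (1 : ℝ) ≤ T := by exact_mod_cast hT
  have hl : 0 ≤ Real.log (T / δ) := Real.log_nonneg (by rw [le_div_iff₀ hδ0]; linarith)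
  have hC := add_le_constC (σ := σ) (rateConst_pos (Δ := Δ) (σ₀ := σ₀) hM hβ).le hα.le hμ0 hμ1
    hδ0 hδ1 d hT
  set C := constC (rateConst M β Δ σ₀) α μ σ δ d T
  set c := rateConst M β Δ σ₀ with hc
  have hc1 : (1 + M * |Δ|) * β / M ^ 2 ≤ c := by
    have p1 : 0 ≤ |Δ| * √β / M := by positivity
    have p2 : 0 ≤ √β / β := by positivity
    have p3 : 0 ≤ 60 / √β := by positivity
    have p4 : 0 ≤ √β * (1 / σ₀ ^ 2 + 1) := by positivity
    rw [hc]
    unfold rateConst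
    linarith
  have hc0 : 0 < c := rateConst_pos hM hβ
  have h1 : c / α ≤ C := by
    refine le_trans ?_ hC
    rw [← mul_one_div]
    gcongr
    have : 0 ≤ (d : ℝ) * (α + σ ^ 2 * (α * Real.log (T / δ))) := by positivity
    linarith
  have hα2 : α ^ 2 * M ^ 2 ≤ β := by
    have h2 : α * M ≤ √β := by
      rw [le_div_iff₀ (by positivity)] at hαM
      nlinarith
    calc α ^ 2 * M ^ 2 = (α * M) ^ 2 := by ring
      _ ≤ √β ^ 2 := by gcongr
      _ = β := Real.sq_sqrt hβ.le
  have h2 : 1 + M * |Δ| ≤ C / α := by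
    rw [le_div_iff₀ hα]
    refine le_trans ?_ h1
    rw [le_div_iff₀ hα]
    refine le_trans ?_ hc1
    rw [le_div_iff₀ (by positivity)]
    calc (1 + M * |Δ|) * α * α * M ^ 2 = (1 + M * |Δ|) * (α ^ 2 * M ^ 2) := by ring
      _ ≤ _ := by gcongr
  have h3 : M * Δ ≤ M * |Δ| := by gcongr; exact le_abs_self Δ
  have h4 : 0 ≤ M * |Δ| := by positivity
  rw [mul_div_assoc, ← div_pow]
  nlinarith

/-- Solves `α Y ≤ C √(R + 2 Y)` for `Y`, according to which of the two summands dominates. -/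
theorem le_max_of_mul_le_mul_sqrt {α C R Y : ℝ} (hα : 0 < α) (hC : 0 ≤ C)
    (hY : 0 ≤ Y) (h : α * Y ≤ C * √(R + 2 * Y)) :
    Y ≤ max (4 * C ^ 2 / α ^ 2) (C / α * √(2 * R)) := by
  rcases le_total R (2 * Y) with hc | hc
  · refine le_max_of_le_left ?_
    have h1 : √(R + 2 * Y) ≤ 2 * √Y := by
      rw [Real.sqrt_le_left (by positivity), mul_pow, Real.sq_sqrt hY]
      linarith
    have h2 : α * Y ≤ 2 * C * √Y := by nlinarith [mul_le_mul_of_nonneg_left h1 hC]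
    rcases hY.eq_or_lt with h0 | hpos
    · rw [← h0]; positivity
    · have hs := Real.sqrt_pos.2 hpos
      have h3 : α * √Y ≤ 2 * C := by
        refine le_of_mul_le_mul_right ?_ hs
        rwa [mul_assoc, Real.mul_self_sqrt hY]
      rw [le_div_iff₀ (by positivity)]
      calc Y * α ^ 2 = (α * √Y) ^ 2 := by rw [mul_pow, Real.sq_sqrt hY]; ring
        _ ≤ (2 * C) ^ 2 := by gcongr
        _ = _ := by ring
  · refine le_max_of_le_right ?_
    rw [div_mul_eq_mul_div, le_div_iff₀ hα, mul_comm Y]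
    refine h.trans ?_
    gcongr
    linarith

theorem iInf_le_sum_div {T : ℕ} (hT : 1 ≤ T) {a : ℕ → ℝ} (ha : ∀ t, 0 ≤ a t) :
    (⨅ t : Fin T, a t) ≤ 1 / T * ∑ t ∈ Finset.range T, a t := by
  have hT' : (0 : ℝ) < T := by exact_mod_cast hT
  have hb : BddBelow (Set.range fun t : Fin T => a t) := ⟨0, by rintro _ ⟨t, rfl⟩; exact ha t⟩
  rw [one_div, ← div_eq_inv_mul, le_div_iff₀ hT', ← Fin.sum_univ_eq_sum_range]
  calc (⨅ t : Fin T, a t) * T = ∑ _t : Fin T, ⨅ t : Fin T, a t := by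
        rw [Finset.sum_const, Finset.card_fin, nsmul_eq_mul, mul_comm]
    _ ≤ _ := Finset.sum_le_sum fun t _ => ciInf_le hb t

end DelayedAdaGrad

/-! ### The high-probability rate -/

theorem theorem2
    (M β Δ σ₀ : ℝ) (hM : 0 < M) (hβ : 0 < β) (hσ₀ : 0 < σ₀) :
    ∃ c : ℝ, 0 < c ∧
      ∀ (d : ℕ) (f : EuclideanSpace ℝ (Fin d) → ℝ) (x₁ : EuclideanSpace ℝ (Fin d)),
        DelayedAdaGrad.IsSmooth M f → BddBelow (Set.range f) → f x₁ - (⨅ x, f x) ≤ Δ →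
      ∀ (Ω Ξ : Type*) [MeasurableSpace Ω] [MeasurableSpace Ξ]
        (P : Measure Ω) [IsProbabilityMeasure P] (ξ : ℕ → Ω → Ξ)
        (g : EuclideanSpace ℝ (Fin d) → Ξ → EuclideanSpace ℝ (Fin d)) (σ : ℝ),
        (∀ t, Measurable (ξ t)) → iIndepFun ξ P →
        Measurable (fun p : EuclideanSpace ℝ (Fin d) × Ξ => g p.1 p.2) →
        (∀ t, DelayedAdaGrad.IsUnbiased f g P (ξ t)) →
        (σ = 0 ∨ σ₀ ≤ σ) →
        (∀ t, DelayedAdaGrad.HasSubGaussianNoise f g P (ξ t) σ) →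
      ∀ (α μ : ℝ), 0 < α → 0 ≤ μ → μ < 1 →
        4 * α ≤ √β * (1 - μ) ^ 2 / (2 * M * (1 + μ)) →
      ∀ (T : ℕ) (δ : ℝ), 1 ≤ T → 0 < δ → δ < 1 →
        ENNReal.ofReal (1 - δ) ≤
          P {ω | (⨅ t : Fin T,
                ‖gradient f (DelayedAdaGrad.iterate g α β μ x₁ (fun i => ξ i ω) t)‖ ^ 2) ≤
              1 / T * max
                (4 * DelayedAdaGrad.constC c α μ σ δ d T ^ 2 / α ^ 2)
                (DelayedAdaGrad.constC c α μ σ δ d T / α *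
                  √(2 * β + 4 * T * σ ^ 2 * Real.log (3 * T * Real.exp 1 / δ)))} := by
  refine ⟨DelayedAdaGrad.rateConst M β Δ σ₀, DelayedAdaGrad.rateConst_pos hM hβ, ?_⟩
  intro d f x₁ hf hb hΔ Ω Ξ _ _ P _ ξ g σ hξ hind hg hunb hσ hnoise α μ hα hμ0 hμ1 hαμ T δ
    hT hδ0 hδ1
  have hσ0 : 0 ≤ σ := by rcases hσ with h | h <;> linarith
  have hαM := DelayedAdaGrad.stepParam_le hM hμ0 hμ1 hαμ
  have hT' : (1 : ℝ) ≤ T := by exact_mod_cast hT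
  refine (DelayedAdaGrad.ofReal_one_sub_le_measure μ x₁ hξ hind hf hg hunb hσ0 hnoise hα hβ hT
    hδ0).trans (measure_mono fun ω hω => ?_)
  obtain ⟨hn, hZ⟩ := Set.mem_ofPred.1 hω
  refine Set.mem_ofPred.2 ((DelayedAdaGrad.iInf_le_sum_div hT fun t => sq_nonneg
    ‖gradient f (DelayedAdaGrad.iterate g α β μ x₁ (fun i => ξ i ω) t)‖).trans ?_)
  gcongr
  rcases hT.eq_or_lt with rfl | hT2
  · rw [Finset.sum_range_one]
    refine le_max_of_le_left (le_trans ?_ (DelayedAdaGrad.two_mul_le_constC_sq hM hβ hα hμ0 hμ1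
      hαM hδ0 hδ1 d le_rfl))
    refine (hf.norm_gradient_sq_le hM hb x₁).trans ?_
    gcongr
  · set L := Real.log (3 * T * Real.exp 1 / δ) with hL
    have hL0 : 0 ≤ L := by
      refine Real.log_nonneg ?_
      rw [le_div_iff₀ hδ0]
      nlinarith [Real.add_one_le_exp 1]
    have hC0 : 0 ≤ DelayedAdaGrad.constC (DelayedAdaGrad.rateConst M β Δ σ₀) α μ σ δ d T := by
      have hc := (DelayedAdaGrad.rateConst_pos (Δ := Δ) (σ₀ := σ₀) hM hβ).le
      have hl : 0 ≤ Real.log (T / δ) := Real.log_nonneg (by rw [le_div_iff₀ hδ0]; linarith)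
      exact le_trans (by positivity) (DelayedAdaGrad.add_le_constC hc hα.le hμ0 hμ1 hδ0 hδ1 d hT)
    have hprog : DelayedAdaGrad.progress f g α β μ x₁ (fun i => ξ i ω) T ≤
        DelayedAdaGrad.constC (DelayedAdaGrad.rateConst M β Δ σ₀) α μ σ δ d T := by
      rcases Nat.eq_zero_or_pos d with rfl | hd
      · simpa [DelayedAdaGrad.progress_eq] using hC0
      · refine le_trans ?_ (DelayedAdaGrad.bound_le_constC (Δ := Δ) hM hβ hσ₀ hα hμ0 hμ1 hαM hσ
          hδ0 hδ1 hd hT2)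
        refine (DelayedAdaGrad.progress_le hf hb hM hα hβ hμ0 hμ1 hαμ (by positivity) T hn
          hZ).trans ?_
        gcongr
    have hY := (DelayedAdaGrad.mul_sum_norm_sq_le_progress hα hβ T hn).trans
      (mul_le_mul_of_nonneg_right hprog (Real.sqrt_nonneg _))
    have hmax := DelayedAdaGrad.le_max_of_mul_le_mul_sqrt hα hC0
      (Finset.sum_nonneg fun _ _ => sq_nonneg _) hY
    have hR : 2 * (β + 2 * (T * (σ ^ 2 * L))) = 2 * β + 4 * T * σ ^ 2 * L := by ring
    rwa [hR] at hmax
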